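/- Let $n\ge 1$ and let $\pi:\mathbb{R}^n\to\mathbb{R}^{n-1}$, $x\mapsto Ax$, be given by a rational matrix $A$ of rank $n-1$. Let $\psi:=\pi^\circ:\mathbb{R}^n\to\mathbb{R}$ be a complementary map, i.e. a linear map whose kernel is the row space of $A$, normalized so that $\psi(\mathbb{Z}^n)\subseteq\mathbb{Z}$. Let $C,D\subseteq\mathbb{R}^n$ be lattice polytopes (convex hulls of nonempty finite subsets of $\mathbb{Z}^n$) and let $w\in\mathbb{R}^n$. Notation. For a polytope $P$ put $\mathrm{face}_w(P)=\arg\max_{x\in P}w^Tx$, $\psi_P=\min_{x\in P}\psi(x)$, $\psi^P=\max_{x\in P}\psi(x)$, and $[P]_i=\arg\max\{w^Tx : x\in P,\ \psi(x)=i+\tfrac12\}$ for $i\in\mathbb{Z}$. The fiber polytope $\Sigma_\psi(P)=\int_{\psi(P)}(\psi^{-1}(t)\cap P)\,dt$ is the Minkowski integral, i.e. the set of all $\int_{\psi(P)}\gamma(t)\,dt$ for integrable $\gamma:\psi(P)\to P$ with $\psi(\gamma(t))=t$. The mixed fiber polytope $\Sigma_\psi(P,Q)$ is the polytope $M_{11}$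 in the expansion $\Sigma_\psi(\lambda P+\mu Q)=\lambda^2M_{20}+\lambda\mu M_{11}+\mu^2M_{02}$ for all $\lambda,\mu>0$, where $M_{20},M_{11},M_{02}$ are polytopes. All sums are Minkowski sums over integers $i$, and an empty sum is $\{0\}$. Theorem. The mixed fiber polytopes $\Sigma_\psi(C,D)$ and $\Sigma_\psi(\mathrm{face}_w(C),\mathrm{face}_w(D))$ exist and are uniquely determined, and $$\Sigma_\psi(\mathrm{face}_w(C),\mathrm{face}_w(D))+\sum_{i=\psi_{C+D}}^{\psi_{\mathrm{face}_w(C+D)}-1}[C+D]_i+\sum_{i=\psi^{\mathrm{face}_w(C+D)}}^{\psi^{C+D}-1}[C+D]_i$$ $$=\ \mathrm{face}_w\Sigma_\psi(C,D)+\sum_{i=\psi_C}^{\psi_{\mathrm{face}_w(C)}-1}[C]_i+\sum_{i=\psi^{\mathrm{face}_w(C)}}^{\psi^C-1}[C]_i+\sum_{i=\psi_D}^{\psi_{\mathrm{face}_w(D)}-1}[D]_i+\sum_{i=\psi^{\mathrm{face}_w(D)}}^{\psi^D-1}[D]_i .$$ -/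

import Mathlib

open scoped Pointwise

noncomputable section

/-- A polytope in `ℝⁿ`: the convex hull of a nonempty finite set of points. -/
def IsPolytope {n : ℕ} (P : Set (Fin n → ℝ)) : Prop :=
  ∃ s : Finset (Fin n → ℝ), s.Nonempty ∧ P = convexHull ℝ (s : Set (Fin n → ℝ))

/-- A lattice polytope in `ℝⁿ`: the convex hull of a nonempty finite set of points of `ℤⁿ`. -/
def IsLatticePolytope {n : ℕ} (P : Set (Fin n → ℝ)) : Prop :=
  ∃ s : Finset (Fin n → ℤ), s.Nonempty ∧
    P = convexHull ℝ ((fun (z : Fin n → ℤ) (j : Fin n) => (z j : ℝ)) '' (s : Set (Fin n → ℤ)))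

/-- `face w P = argmax_{x ∈ P} wᵀ x`. -/
def face {n : ℕ} (w : Fin n → ℝ) (P : Set (Fin n → ℝ)) : Set (Fin n → ℝ) :=
  {x | x ∈ P ∧ ∀ y ∈ P, w ⬝ᵥ y ≤ w ⬝ᵥ x}

/-- The fiber polytope `∫_{ψ(P)} (ψ⁻¹(t) ∩ P) dt`. The Minkowski integral is the set of the
integrals of all integrable sections `γ` of `ψ` over `ψ(P)` with values in `P`
(no normalization by the length of `ψ(P)`). -/
def fiberPolytope {n : ℕ} (ψ : (Fin n → ℝ) →ₗ[ℝ] ℝ) (P : Set (Fin n → ℝ)) :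
    Set (Fin n → ℝ) :=
  {y | ∃ γ : ℝ → (Fin n → ℝ),
      MeasureTheory.IntegrableOn γ (ψ '' P) ∧
      (∀ t ∈ ψ '' P, γ t ∈ P ∧ ψ (γ t) = t) ∧
      y = ∫ t in ψ '' P, γ t}

/-- `M` is the coefficient of `a * b` in the expansion of the fiber polytope of `a • P + b • Q`
(`a, b > 0`) as a homogeneous quadratic polynomial in `a, b` whose coefficients are polytopes;
sums are Minkowski sums. -/
def IsMixedFiberPolytope {n : ℕ} (ψ : (Fin n → ℝ) →ₗ[ℝ] ℝ) (P Q M : Set (Fin n → ℝ)) : Prop :=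
  IsPolytope M ∧ ∃ M₂₀ M₀₂ : Set (Fin n → ℝ), IsPolytope M₂₀ ∧ IsPolytope M₀₂ ∧
    ∀ a b : ℝ, 0 < a → 0 < b →
      fiberPolytope ψ (a • P + b • Q) = a ^ 2 • M₂₀ + (a * b) • M + b ^ 2 • M₀₂

open Classical in
/-- The mixed fiber polytope `Σ_ψ(P, Q)`: the set characterized by `IsMixedFiberPolytope`
(the empty set if there is none). -/
def mixedFiberPolytope {n : ℕ} (ψ : (Fin n → ℝ) →ₗ[ℝ] ℝ) (P Q : Set (Fin n → ℝ)) :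
    Set (Fin n → ℝ) :=
  if h : ∃ M, IsMixedFiberPolytope ψ P Q M then h.choose else ∅

/-- `ψ_P = min_{x ∈ P} ψ(x)` (a minimum for nonempty compact `P`). -/
def psiMin {n : ℕ} (ψ : (Fin n → ℝ) →ₗ[ℝ] ℝ) (P : Set (Fin n → ℝ)) : ℝ := sInf (ψ '' P)

/-- `ψ^P = max_{x ∈ P} ψ(x)` (a maximum for nonempty compact `P`). -/
def psiMax {n : ℕ} (ψ : (Fin n → ℝ) →ₗ[ℝ] ℝ) (P : Set (Fin n → ℝ)) : ℝ := sSup (ψ '' P)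

/-- `[P]_i = argmax { wᵀ x : x ∈ P, ψ(x) = i + 1/2 }`. -/
def sliceFace {n : ℕ} (ψ : (Fin n → ℝ) →ₗ[ℝ] ℝ) (w : Fin n → ℝ) (P : Set (Fin n → ℝ)) (i : ℤ) :
    Set (Fin n → ℝ) :=
  face w (P ∩ ψ ⁻¹' {(i : ℝ) + 1 / 2})

/-- The Minkowski sum of the `[P]_i` over all integers `i` with `a ≤ i ≤ b - 1`;
the empty sum is `{0}`. -/
def sliceFaceSum {n : ℕ} (ψ : (Fin n → ℝ) →ₗ[ℝ] ℝ) (w : Fin n → ℝ) (P : Set (Fin n → ℝ))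
    (a b : ℝ) : Set (Fin n → ℝ) :=
  ∑ i ∈ Finset.Icc ⌈a⌉ ⌊b - 1⌋, sliceFace ψ w P i

/-- `ψ` is a complementary map of the projection `x ↦ A x`: its kernel is the (real) row space
of `A`, and it is normalized to take integer values on `ℤⁿ`. -/
def IsComplementaryMap {m n : ℕ} (A : Matrix (Fin m) (Fin n) ℚ) (ψ : (Fin n → ℝ) →ₗ[ℝ] ℝ) :
    Prop :=
  LinearMap.ker ψ = Submodule.span ℝ (Set.range fun (i : Fin m) (j : Fin n) => (A i j : ℝ)) ∧
    ∀ z : Fin n → ℤ, ∃ k : ℤ, ψ (fun j => (z j : ℝ)) = k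

end

namespace FiberPolytope

open Set MeasureTheory

variable {n : ℕ}

/-! ### Polytopes and support functions -/

/-! The generators of a lattice polytope `P` have integral `ψ`-values, so none lies strictly between
two consecutive integral levels and the slices of `P` interpolate linearly there. The integral of
the sections over `[i, i + 1]` is therefore the middle slice, and the fiber polytope of `P` is the
Minkowski sum of the slices at the levels `i + 1/2` (`HasRange.fiberPolytope_eq`). Taking `w`-faces
commutes with Minkowski sums. A middle slice that meets `face w P` has as its `w`-face the
corresponding slice of `face w P`; every other one contributes `[P]_i`. This describes the face of a
fiber polytope (`face_fiberPolytope`).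

Apply this to `C + D`, `C` and `D`, and expand the fiber polytopes of `C + D` and of `face w C +
face w D` with `fiberPolytope_add`. Both sides of the theorem then agree after adding the fiber
polytopes of `face w C` and `face w D`, and these cancel because support functions determine
polytopes.

The substantial part is the existence of the mixed fiber polytope, for real weights `a, b`
(`fiberPolytope_smul_add_smul`). A monotone lattice path through the rectangle of levels of `C` and
`D` subdivides the range of `ψ` on `a • C + b • D`: a horizontal step moves through `C` while a
point of `D` is held fixed, and a vertical step does the reverse. The mixed term is the hull over
all paths of the contributions of the fixed points (`pathHull`). Every path yields integrals of
sections (`sum_mem_secInt`). Conversely, for each functional `u` the support functions of the slices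
are concave along the levels, and the path that always takes the larger available slope gives a
matching upper bound (`pathBound`). -/

theorem isPolytope_singleton_zero : IsPolytope ({0} : Set (Fin n → ℝ)) :=
  ⟨{0}, by simp, by simp⟩

theorem isPolytope_of_finite {s : Set (Fin n → ℝ)} (hs : s.Finite) (h : s.Nonempty) :
    IsPolytope (convexHull ℝ s) :=
  ⟨hs.toFinset, by simpa using h, by simp⟩

theorem _root_.IsPolytope.nonempty {P : Set (Fin n → ℝ)} (h : IsPolytope P) : P.Nonempty := by
  obtain ⟨s, hs, rfl⟩ := h
  simpa using hs

theorem _root_.IsPolytope.convex {P : Set (Fin n → ℝ)} (h : IsPolytope P) : Convex ℝ P := by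
  obtain ⟨s, hs, rfl⟩ := h
  exact convex_convexHull ℝ _

theorem _root_.IsPolytope.isCompact {P : Set (Fin n → ℝ)} (h : IsPolytope P) : IsCompact P := by
  obtain ⟨s, hs, rfl⟩ := h
  exact s.finite_toSet.isCompact_convexHull ℝ

theorem _root_.IsPolytope.add {P Q : Set (Fin n → ℝ)} (hP : IsPolytope P) (hQ : IsPolytope Q) :
    IsPolytope (P + Q) := by
  obtain ⟨s, hs, rfl⟩ := hP
  obtain ⟨t, ht, rfl⟩ := hQ
  rw [← convexHull_add]
  exact isPolytope_of_finite (s.finite_toSet.add t.finite_toSet) (by simpa using ⟨hs, ht⟩)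

theorem _root_.IsPolytope.smul {P : Set (Fin n → ℝ)} (hP : IsPolytope P) (a : ℝ) :
    IsPolytope (a • P) := by
  obtain ⟨s, hs, rfl⟩ := hP
  rw [← convexHull_smul]
  exact isPolytope_of_finite s.finite_toSet.smul_set (by simpa using hs)

theorem _root_.IsPolytope.convexHull_union {P Q : Set (Fin n → ℝ)} (hP : IsPolytope P)
    (hQ : IsPolytope Q) : IsPolytope (convexHull ℝ (P ∪ Q)) := by
  obtain ⟨s, hs, rfl⟩ := hP
  obtain ⟨t, ht, rfl⟩ := hQ
  rw [convexHull_convexHull_union_left, convexHull_convexHull_union_right]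
  exact isPolytope_of_finite (s.finite_toSet.union t.finite_toSet)
    (Set.Nonempty.inl (by simpa using hs))

/-- The support function of `K` at the functional `u`. -/
noncomputable def supp (u : (Fin n → ℝ) →L[ℝ] ℝ) (K : Set (Fin n → ℝ)) : ℝ := sSup (u '' K)

theorem bddAbove_image {K : Set (Fin n → ℝ)} (hK : IsCompact K) (u : (Fin n → ℝ) →L[ℝ] ℝ) :
    BddAbove (u '' K) :=
  (hK.image u.continuous).bddAbove

theorem le_supp {K : Set (Fin n → ℝ)} (hK : IsCompact K) (u : (Fin n → ℝ) →L[ℝ] ℝ)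
    {x : Fin n → ℝ} (hx : x ∈ K) : u x ≤ supp u K :=
  le_csSup (bddAbove_image hK u) (mem_image_of_mem _ hx)

theorem exists_eq_supp {K : Set (Fin n → ℝ)} (hK : IsCompact K) (hne : K.Nonempty)
    (u : (Fin n → ℝ) →L[ℝ] ℝ) : ∃ x ∈ K, u x = supp u K := by
  have := (hK.image u.continuous).sSup_mem (hne.image u)
  exact this

theorem supp_mono {K L : Set (Fin n → ℝ)} (hL : IsCompact L) (hne : K.Nonempty) (h : K ⊆ L)
    (u : (Fin n → ℝ) →L[ℝ] ℝ) : supp u K ≤ supp u L :=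
  csSup_le_csSup (bddAbove_image hL u) (hne.image u) (image_mono h)

theorem supp_add {K L : Set (Fin n → ℝ)} (hK : IsCompact K) (hK' : K.Nonempty)
    (hL : IsCompact L) (hL' : L.Nonempty) (u : (Fin n → ℝ) →L[ℝ] ℝ) :
    supp u (K + L) = supp u K + supp u L := by
  unfold supp
  rw [image_add, csSup_add (hK'.image u) (bddAbove_image hK u) (hL'.image u)
    (bddAbove_image hL u)]

theorem supp_smul (K : Set (Fin n → ℝ)) {a : ℝ} (ha : 0 ≤ a) (u : (Fin n → ℝ) →L[ℝ] ℝ) :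
    supp u (a • K) = a * supp u K := by
  unfold supp
  rw [image_smul_set, Real.sSup_smul_of_nonneg ha, smul_eq_mul]

@[simp] theorem supp_singleton_zero (u : (Fin n → ℝ) →L[ℝ] ℝ) :
    supp u {0} = 0 := by
  simp [supp]

/-- A point outside a compact convex set is strictly separated from it by Hahn–Banach. -/
theorem mem_of_forall_le_supp {K : Set (Fin n → ℝ)} (hK : IsCompact K) (hne : K.Nonempty)
    (hc : Convex ℝ K) {x : Fin n → ℝ} (h : ∀ u : (Fin n → ℝ) →L[ℝ] ℝ, u x ≤ supp u K) :
    x ∈ K := by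
  by_contra hx
  obtain ⟨f, r, h1, h2⟩ := geometric_hahn_banach_closed_point hc hK.isClosed hx
  obtain ⟨y, hy, hy'⟩ := exists_eq_supp hK hne f
  have := h1 y hy
  have := h f
  linarith

theorem _root_.IsPolytope.eq_of_supp_eq {K L : Set (Fin n → ℝ)} (hK : IsPolytope K) (hL : IsPolytope L)
    (h : ∀ u : (Fin n → ℝ) →L[ℝ] ℝ, supp u K = supp u L) : K = L := by
  apply Subset.antisymm
  · intro x hx
    exact mem_of_forall_le_supp hL.isCompact hL.nonempty hL.convex
      fun u => h u ▸ le_supp hK.isCompact u hx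
  · intro x hx
    exact mem_of_forall_le_supp hK.isCompact hK.nonempty hK.convex
      fun u => h u ▸ le_supp hL.isCompact u hx

theorem _root_.IsPolytope.supp_add {K L : Set (Fin n → ℝ)} (hK : IsPolytope K) (hL : IsPolytope L)
    (u : (Fin n → ℝ) →L[ℝ] ℝ) : supp u (K + L) = supp u K + supp u L :=
  FiberPolytope.supp_add hK.isCompact hK.nonempty hL.isCompact hL.nonempty u

/-- Minkowski cancellation for polytopes. -/
theorem _root_.IsPolytope.add_right_cancel {K L S : Set (Fin n → ℝ)} (hK : IsPolytope K)
    (hL : IsPolytope L) (hS : IsPolytope S) (h : K + S = L + S) : K = L := by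
  refine hK.eq_of_supp_eq hL fun u => ?_
  have := congrArg (supp u) h
  rw [hK.supp_add hS, hL.supp_add hS] at this
  linarith

/-! ### Faces -/

theorem mem_face_of_le {w : Fin n → ℝ} {P : Set (Fin n → ℝ)} {x y : Fin n → ℝ} (hx : x ∈ face w P)
    (hy : y ∈ P) (h : w ⬝ᵥ x ≤ w ⬝ᵥ y) : y ∈ face w P :=
  ⟨hy, fun z hz => (hx.2 z hz).trans h⟩

theorem face_add (w : Fin n → ℝ) (K L : Set (Fin n → ℝ)) :
    face w (K + L) = face w K + face w L := by
  ext x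
  constructor
  · rintro ⟨⟨k, hk, l, hl, rfl⟩, h⟩
    refine ⟨k, ⟨hk, fun y hy => ?_⟩, l, ⟨hl, fun y hy => ?_⟩, rfl⟩
    · have := h _ (add_mem_add hy hl)
      simpa [dotProduct_add] using this
    · have := h _ (add_mem_add hk hy)
      simpa [dotProduct_add] using this
  · rintro ⟨k, hk, l, hl, rfl⟩
    refine ⟨add_mem_add hk.1 hl.1, ?_⟩
    rintro _ ⟨k', hk', l', hl', rfl⟩
    simpa [dotProduct_add] using add_le_add (hk.2 k' hk') (hl.2 l' hl')

@[simp] theorem face_zero (w : Fin n → ℝ) : face w (0 : Set (Fin n → ℝ)) = 0 := by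
  ext x
  simp only [face, mem_ofPred_eq, Set.mem_zero]
  constructor
  · exact fun h => h.1
  · rintro rfl
    exact ⟨rfl, by simp⟩

theorem face_sum {ι : Type*} (w : Fin n → ℝ) (s : Finset ι) (K : ι → Set (Fin n → ℝ)) :
    face w (∑ i ∈ s, K i) = ∑ i ∈ s, face w (K i) := by
  classical
  induction s using Finset.induction_on with
  | empty => simp
  | insert i s hi ih => rw [Finset.sum_insert hi, Finset.sum_insert hi, face_add, ih]

theorem face_nonempty {w : Fin n → ℝ} {P : Set (Fin n → ℝ)} (hP : IsCompact P)
    (hne : P.Nonempty) : (face w P).Nonempty := by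
  have hc : Continuous fun x : Fin n → ℝ => w ⬝ᵥ x :=
    Continuous.dotProduct continuous_const continuous_id
  obtain ⟨x, hx, h⟩ := hP.exists_isMaxOn hne hc.continuousOn
  exact ⟨x, hx, fun y hy => h hy⟩

/-- The linear functional `x ↦ w ⬝ᵥ x`. -/
noncomputable def dotCLM (w : Fin n → ℝ) : (Fin n → ℝ) →L[ℝ] ℝ :=
  LinearMap.toContinuousLinearMap (dotProductBilin ℝ ℝ w)

@[simp] theorem dotCLM_apply (w x : Fin n → ℝ) : dotCLM w x = w ⬝ᵥ x := rfl

theorem isExposed_face (w : Fin n → ℝ) (P : Set (Fin n → ℝ)) : IsExposed ℝ P (face w P) :=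
  fun _ => ⟨dotCLM w, rfl⟩

/-- Extreme points of an exposed face are extreme in the whole hull, hence belong to `s`.
Krein–Milman recovers the face from these finitely many points, whose hull is already closed.
Keeping the generators inside `s` preserves integrality of `ψ` on faces. -/
theorem exists_convexHull_of_isExposed {s : Finset (Fin n → ℝ)} {F : Set (Fin n → ℝ)}
    (h : IsExposed ℝ (convexHull ℝ (s : Set (Fin n → ℝ))) F) :
    ∃ t ⊆ s, F = convexHull ℝ (t : Set (Fin n → ℝ)) := by
  classical
  have hP : IsCompact (convexHull ℝ (s : Set (Fin n → ℝ))) :=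
    s.finite_toSet.isCompact_convexHull ℝ
  have hF := h.isCompact hP
  have hFc := h.convex (convex_convexHull ℝ _)
  have hext : extremePoints ℝ F ⊆ s := by
    rw [h.isExtreme.extremePoints_eq]
    exact inter_subset_right.trans extremePoints_convexHull_subset
  have hfin : (extremePoints ℝ F).Finite := s.finite_toSet.subset hext
  refine ⟨hfin.toFinset, by simpa [← Finset.coe_subset] using hext, ?_⟩
  rw [hfin.coe_toFinset]
  conv_lhs => rw [← closure_convexHull_extremePoints hF hFc]
  exact (hfin.isCompact_convexHull ℝ).isClosed.closure_eq

theorem isPolytope_face {P : Set (Fin n → ℝ)} (hP : IsPolytope P) (w : Fin n → ℝ) :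
    IsPolytope (face w P) := by
  have hne := face_nonempty (w := w) hP.isCompact hP.nonempty
  obtain ⟨s, hs, rfl⟩ := hP
  obtain ⟨t, -, ht⟩ := exists_convexHull_of_isExposed (isExposed_face w _)
  refine ⟨t, ?_, ht⟩
  rw [ht] at hne
  simpa using hne

/-! ### Slices and integrals of sections -/

/-- The slice of `P` at level `t`. -/
def slice (ψ : (Fin n → ℝ) →ₗ[ℝ] ℝ) (P : Set (Fin n → ℝ)) (t : ℝ) : Set (Fin n → ℝ) :=
  P ∩ ψ ⁻¹' {t}

theorem isCompact_slice {ψ : (Fin n → ℝ) →ₗ[ℝ] ℝ} {P : Set (Fin n → ℝ)} (hP : IsCompact P)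
    (t : ℝ) : IsCompact (slice ψ P t) :=
  hP.inter_right (isClosed_singleton.preimage ψ.continuous_of_finiteDimensional)

theorem convex_slice {ψ : (Fin n → ℝ) →ₗ[ℝ] ℝ} {P : Set (Fin n → ℝ)} (hP : Convex ℝ P)
    (t : ℝ) : Convex ℝ (slice ψ P t) :=
  hP.inter ((convex_singleton t).linear_preimage ψ)

theorem image_nonempty_slice {ψ : (Fin n → ℝ) →ₗ[ℝ] ℝ} {P : Set (Fin n → ℝ)} {t : ℝ} :
    (slice ψ P t).Nonempty ↔ t ∈ ψ '' P := Iff.rfl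

/-- The set of the integrals over `[s, t]` of the integrable sections of `ψ` with values
in `P`. -/
def secInt (ψ : (Fin n → ℝ) →ₗ[ℝ] ℝ) (P : Set (Fin n → ℝ)) (s t : ℝ) : Set (Fin n → ℝ) :=
  {y | ∃ γ : ℝ → (Fin n → ℝ), IntegrableOn γ (Icc s t) ∧
      (∀ x ∈ Icc s t, γ x ∈ P ∧ ψ (γ x) = x) ∧ y = ∫ x in Icc s t, γ x}

theorem fiberPolytope_eq_secInt {ψ : (Fin n → ℝ) →ₗ[ℝ] ℝ} {P : Set (Fin n → ℝ)} {s t : ℝ}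
    (h : ψ '' P = Icc s t) : fiberPolytope ψ P = secInt ψ P s t := by
  unfold fiberPolytope secInt
  rw [h]

theorem convex_secInt (ψ : (Fin n → ℝ) →ₗ[ℝ] ℝ) {P : Set (Fin n → ℝ)} (hP : Convex ℝ P)
    (s t : ℝ) : Convex ℝ (secInt ψ P s t) := by
  rintro _ ⟨γ, hγ, hγ', rfl⟩ _ ⟨δ, hδ, hδ', rfl⟩ a b ha hb hab
  refine ⟨fun x => a • γ x + b • δ x, (hγ.smul a).add (hδ.smul b), fun x hx => ⟨?_, ?_⟩, ?_⟩
  · exact hP (hγ' x hx).1 (hδ' x hx).1 ha hb hab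
  · simp [(hγ' x hx).2, (hδ' x hx).2, ← add_mul, hab]
  · exact ((integral_add (hγ.smul a) (hδ.smul b)).trans
      (by simp only [Pi.smul_apply, integral_smul])).symm

theorem secInt_self {ψ : (Fin n → ℝ) →ₗ[ℝ] ℝ} {P : Set (Fin n → ℝ)} {s : ℝ}
    (h : (slice ψ P s).Nonempty) : secInt ψ P s s = {0} := by
  obtain ⟨p, hp, hps⟩ := h
  ext y
  constructor
  · rintro ⟨γ, -, -, rfl⟩
    simp
  · rintro rfl
    refine ⟨fun _ => p, by simp, fun x hx => ?_, by simp⟩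
    rw [Icc_self] at hx
    exact ⟨hp, hps.trans hx.symm⟩

/-- Sections on adjacent intervals may be glued without any compatibility at `t`, since they need
only be integrable and a single point has measure zero. -/
theorem secInt_add {ψ : (Fin n → ℝ) →ₗ[ℝ] ℝ} {P : Set (Fin n → ℝ)} {s t v : ℝ} (hst : s ≤ t)
    (htv : t ≤ v) : secInt ψ P s t + secInt ψ P t v = secInt ψ P s v := by
  have hU : Icc s v = Icc s t ∪ Ioc t v := (Icc_union_Ioc_eq_Icc hst htv).symm
  have hD : Disjoint (Icc s t) (Ioc t v) :=
    Set.disjoint_left.2 fun x hx hx' => absurd hx.2 (not_le.2 hx'.1)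
  ext y
  constructor
  · rintro ⟨_, ⟨γ, hγ, hγ', rfl⟩, _, ⟨δ, hδ, hδ', rfl⟩, rfl⟩
    classical
    have e1 : EqOn (fun x => if x ≤ t then γ x else δ x) γ (Icc s t) :=
      fun x hx => if_pos hx.2
    have e2 : EqOn (fun x => if x ≤ t then γ x else δ x) δ (Ioc t v) :=
      fun x hx => if_neg (not_le.2 hx.1)
    have i1 := (integrableOn_congr_fun e1 measurableSet_Icc).2 hγ
    have i2 := (integrableOn_congr_fun e2 measurableSet_Ioc).2 (hδ.mono_set Ioc_subset_Icc_self)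
    refine ⟨fun x => if x ≤ t then γ x else δ x, ?_, fun x hx => ?_, ?_⟩
    · rw [hU]
      exact i1.union i2
    · dsimp only
      split_ifs with h
      · exact hγ' x ⟨hx.1, h⟩
      · exact hδ' x ⟨(not_le.1 h).le, hx.2⟩
    · rw [hU, setIntegral_union hD measurableSet_Ioc i1 i2,
        setIntegral_congr_fun measurableSet_Icc e1, setIntegral_congr_fun measurableSet_Ioc e2,
        integral_Icc_eq_integral_Ioc (x := t)]
  · rintro ⟨γ, hγ, hγ', rfl⟩
    have i1 := hγ.mono_set (Icc_subset_Icc_right htv)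
    have i2 := hγ.mono_set (Icc_subset_Icc_left hst)
    refine ⟨_, ⟨γ, i1, fun x hx => hγ' x ⟨hx.1, hx.2.trans htv⟩, rfl⟩,
      _, ⟨γ, i2, fun x hx => hγ' x ⟨hst.trans hx.1, hx.2⟩, rfl⟩, ?_⟩
    dsimp only
    rw [hU, setIntegral_union hD measurableSet_Ioc i1 (i2.mono_set Ioc_subset_Icc_self),
        integral_Icc_eq_integral_Ioc (x := t)]

theorem integral_id_Icc {s t : ℝ} (h : s ≤ t) : ∫ x in Icc s t, x = (t - s) * ((s + t) / 2) := by
  rw [integral_Icc_eq_integral_Ioc, ← intervalIntegral.integral_of_le h, integral_id]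
  ring

/-- The mean value of a section lies in the middle slice. -/
theorem secInt_subset_smul_slice {ψ : (Fin n → ℝ) →ₗ[ℝ] ℝ} {P : Set (Fin n → ℝ)}
    (hc : Convex ℝ P) (hcl : IsClosed P) {s t : ℝ} (h : s < t) :
    secInt ψ P s t ⊆ (t - s) • slice ψ P ((s + t) / 2) := by
  rintro _ ⟨γ, hγ, hγ', rfl⟩
  have hpos : 0 < t - s := sub_pos.2 h
  have havg : (⨍ x in Icc s t, γ x) = (t - s)⁻¹ • ∫ x in Icc s t, γ x := by
    rw [setAverage_eq]
    simp [hpos.le]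
  refine ⟨(t - s)⁻¹ • ∫ x in Icc s t, γ x, ⟨?_, ?_⟩, ?_⟩
  · rw [← havg]
    refine hc.set_average_mem hcl (by simp [h]) (by simp) ?_ hγ
    exact (ae_restrict_iff' measurableSet_Icc).2 (.of_forall fun x hx => (hγ' x hx).1)
  · have hψ : ψ (∫ x in Icc s t, γ x) = ∫ x in Icc s t, x := by
      have := (LinearMap.toContinuousLinearMap ψ).integral_comp_comm hγ
      simp only [LinearMap.coe_toContinuousLinearMap'] at this
      rw [← this]
      exact setIntegral_congr_fun measurableSet_Icc fun x hx => (hγ' x hx).2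
    simp only [mem_preimage, map_smul, hψ, mem_singleton_iff, smul_eq_mul]
    rw [integral_id_Icc h.le]
    field_simp
  · exact smul_inv_smul₀ hpos.ne' _

/-- The integral of the linear section joining two points. -/
theorem smul_midpoint_mem_secInt {ψ : (Fin n → ℝ) →ₗ[ℝ] ℝ} {P : Set (Fin n → ℝ)}
    (hc : Convex ℝ P) {s t : ℝ} (h : s < t) {p q : Fin n → ℝ} (hp : p ∈ slice ψ P s)
    (hq : q ∈ slice ψ P t) : (t - s) • ((1 / 2 : ℝ) • p + (1 / 2 : ℝ) • q) ∈ secInt ψ P s t := by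
  have hpos : 0 < t - s := sub_pos.2 h
  have hcont : Continuous fun x : ℝ => p + ((x - s) / (t - s)) • (q - p) := by fun_prop
  refine ⟨fun x => p + ((x - s) / (t - s)) • (q - p), ?_, fun x hx => ⟨?_, ?_⟩, ?_⟩
  · exact hcont.continuousOn.integrableOn_compact isCompact_Icc
  · exact hc.add_smul_sub_mem hp.1 hq.1
      ⟨div_nonneg (sub_nonneg.2 hx.1) hpos.le, (div_le_one hpos).2 (by linarith [hx.2])⟩
  · have h1 : ψ p = s := hp.2
    have h2 : ψ q = t := hq.2
    simp only [map_add, map_smul, map_sub, h1, h2, smul_eq_mul]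
    field_simp
    ring
  · have e : ∀ x : ℝ, p + ((x - s) / (t - s)) • (q - p)
        = (p - (s / (t - s)) • (q - p)) + x • ((t - s)⁻¹ • (q - p)) := by
      intro x
      rw [smul_smul]
      have : (x - s) / (t - s) = x * (t - s)⁻¹ - s / (t - s) := by ring
      rw [this, sub_smul]
      abel
    simp only [e]
    have i1 : IntegrableOn (fun _ : ℝ => p - (s / (t - s)) • (q - p)) (Icc s t) :=
      continuous_const.continuousOn.integrableOn_compact isCompact_Icc
    have i2 : IntegrableOn (fun x : ℝ => x • ((t - s)⁻¹ • (q - p))) (Icc s t) :=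
      Continuous.integrableOn_Icc (by fun_prop)
    rw [integral_add i1 i2, integral_smul_const, integral_id_Icc h.le, setIntegral_const]
    simp only [Measure.real, Real.volume_Icc, ENNReal.toReal_ofReal hpos.le]
    ext j
    simp only [Pi.add_apply, Pi.smul_apply, Pi.sub_apply, smul_eq_mul]
    field_simp
    ring

section

/-! ### Slices of polytopes -/

theorem exists_mem_segment_of_union {s s₁ s₂ : Set (Fin n → ℝ)} (h : s ⊆ s₁ ∪ s₂)
    {x : Fin n → ℝ} (hx : x ∈ convexHull ℝ s) (h1 : x ∉ convexHull ℝ s₁)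
    (h2 : x ∉ convexHull ℝ s₂) :
    ∃ y ∈ convexHull ℝ s₁, ∃ z ∈ convexHull ℝ s₂, x ∈ segment ℝ y z := by
  have hx' := convexHull_mono h hx
  rcases s₁.eq_empty_or_nonempty with rfl | hs₁
  · rw [empty_union] at hx'
    exact absurd hx' h2
  rcases s₂.eq_empty_or_nonempty with rfl | hs₂
  · rw [union_empty] at hx'
    exact absurd hx' h1
  rw [convexHull_union hs₁ hs₂, mem_convexJoin] at hx'
  exact hx'

theorem smul_add_smul_mem_smul {K : Set (Fin n → ℝ)} (hK : Convex ℝ K) {x y : Fin n → ℝ}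
    {a b r r' : ℝ} (ha : 0 ≤ a) (hb : 0 ≤ b) (hr : 0 ≤ r) (hr' : 0 ≤ r') (hx : x ∈ r • K)
    (hy : y ∈ r' • K) : a • x + b • y ∈ (a * r + b * r') • K := by
  rw [hK.add_smul (mul_nonneg ha hr) (mul_nonneg hb hr'), mul_smul, mul_smul]
  exact add_mem_add (smul_mem_smul_set hx) (smul_mem_smul_set hy)

/-- A nonempty slice of a polytope is a polytope. -/
theorem isPolytope_slice {ψ : (Fin n → ℝ) →ₗ[ℝ] ℝ} {P : Set (Fin n → ℝ)} (hP : IsPolytope P)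
    {t : ℝ} (hne : (slice ψ P t).Nonempty) : IsPolytope (slice ψ P t) := by
  classical
  obtain ⟨s, hs, rfl⟩ := hP
  set P := convexHull ℝ (s : Set (Fin n → ℝ)) with hPdef
  have hPc : Convex ℝ P := convex_convexHull ℝ _
  -- The point at which the line through the two given points crosses level `t`.
  let cr : (Fin n → ℝ) × (Fin n → ℝ) → (Fin n → ℝ) := fun vz =>
    ((ψ vz.2 - ψ vz.1)⁻¹) • ((ψ vz.2 - t) • vz.1 + (t - ψ vz.1) • vz.2)
  let W : Finset (Fin n → ℝ) := ((s ×ˢ s).image cr ∪ s).filter (· ∈ slice ψ P t)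
  set K := convexHull ℝ (W : Set (Fin n → ℝ)) with hK
  have hKc : Convex ℝ K := convex_convexHull ℝ _
  have hWK : ∀ x ∈ W, x ∈ K := fun x hx => subset_convexHull ℝ _ hx
  have key : slice ψ P t = K := by
    apply Subset.antisymm
    · rintro x ⟨hx, hxt⟩
      have hxt : ψ x = t := hxt
      by_cases h2 : x ∈ convexHull ℝ {v | v ∈ s ∧ t < ψ v}
      · have : convexHull ℝ {v | v ∈ s ∧ t < ψ v} ⊆ {v | t < ψ v} :=
          convexHull_min (fun v hv => hv.2) (convex_halfSpace_gt ψ.isLinear t)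
        exact absurd (this h2) (by simp [hxt])
      -- Here `x` maximizes `ψ` on this hull, so it lies in an exposed face, all of whose generators
      -- have level exactly `t`.
      by_cases h1 : x ∈ convexHull ℝ {v | v ∈ s ∧ ψ v ≤ t}
      · have hsub : convexHull ℝ {v | v ∈ s ∧ ψ v ≤ t} ⊆ {v | ψ v ≤ t} :=
          convexHull_min (fun v hv => hv.2) (convex_halfSpace_le ψ.isLinear t)
        have hco : ((s.filter (ψ · ≤ t) : Finset _) : Set (Fin n → ℝ)) = {v | v ∈ s ∧ ψ v ≤ t} := by
          ext v; simp
        rw [← hco] at h1 hsub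
        have hex : IsExposed ℝ (convexHull ℝ ((s.filter (ψ · ≤ t) : Finset _) : Set (Fin n → ℝ)))
            {y | y ∈ convexHull ℝ ((s.filter (ψ · ≤ t) : Finset _) : Set (Fin n → ℝ)) ∧
              ∀ z ∈ convexHull ℝ ((s.filter (ψ · ≤ t) : Finset _) : Set (Fin n → ℝ)),
                ψ z ≤ ψ y} :=
          fun _ => ⟨LinearMap.toContinuousLinearMap ψ, rfl⟩
        obtain ⟨T, hTs, hT⟩ := exists_convexHull_of_isExposed hex
        have hxT : x ∈ convexHull ℝ (T : Set (Fin n → ℝ)) := by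
          rw [← hT]
          exact ⟨h1, fun z hz => hxt ▸ hsub hz⟩
        refine convexHull_mono (fun v hv => ?_) hxT
        have hv1 := (hT.symm ▸ subset_convexHull ℝ _ hv :)
        have hv2 := Finset.mem_filter.1 (hTs hv)
        refine Finset.mem_filter.2 ⟨Finset.mem_union_right _ hv2.1,
          subset_convexHull ℝ _ hv2.1, ?_⟩
        exact le_antisymm hv2.2 (hxt ▸ hv1.2 x h1)
      obtain ⟨y, hy, z, hz, hxyz⟩ := exists_mem_segment_of_union (s := (s : Set (Fin n → ℝ)))
        (s₁ := {v | v ∈ s ∧ ψ v ≤ t}) (s₂ := {v | v ∈ s ∧ t < ψ v})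
        (fun v hv => (le_or_gt (ψ v) t).imp (fun h => ⟨hv, h⟩) (fun h => ⟨hv, h⟩)) hx h1 h2
      -- With the denominator cleared, the claim about the crossing point is affine in each endpoint
      -- separately. Convexity of `K` then carries it from generators to the two hulls, one endpoint
      -- at a time.
      have step1 : ∀ v ∈ {v | v ∈ s ∧ ψ v ≤ t}, ∀ z ∈ {v | v ∈ s ∧ t < ψ v},
          (ψ z - t) • v + (t - ψ v) • z ∈ (ψ z - ψ v) • K := by
        rintro v ⟨hv, hvt⟩ z ⟨hz, hzt⟩
        have hpos : 0 < ψ z - ψ v := by linarith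
        refine ⟨cr (v, z), hWK _ (Finset.mem_filter.2 ⟨Finset.mem_union_left _
          (Finset.mem_image_of_mem _ (Finset.mk_mem_product hv hz)), ?_, ?_⟩), ?_⟩
        · have := hPc (subset_convexHull ℝ _ hv) (subset_convexHull ℝ _ hz)
            (a := (ψ z - ψ v)⁻¹ * (ψ z - t)) (b := (ψ z - ψ v)⁻¹ * (t - ψ v))
            (mul_nonneg (inv_nonneg.2 hpos.le) (by linarith))
            (mul_nonneg (inv_nonneg.2 hpos.le) (by linarith)) (by field_simp; ring)
          rw [mul_smul, mul_smul, ← smul_add] at this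
          exact this
        · simp only [cr, mem_preimage, mem_singleton_iff, map_smul, map_add, smul_eq_mul]
          field_simp
          ring
        · exact smul_inv_smul₀ hpos.ne' _
      have step2 : ∀ v ∈ {v | v ∈ s ∧ ψ v ≤ t}, ∀ z ∈ convexHull ℝ {v | v ∈ s ∧ t < ψ v},
          t < ψ z ∧ (ψ z - t) • v + (t - ψ v) • z ∈ (ψ z - ψ v) • K := by
        intro v hv z hz
        refine convexHull_min (t := {z | t < ψ z ∧
          (ψ z - t) • v + (t - ψ v) • z ∈ (ψ z - ψ v) • K})
          (fun z hz => ⟨hz.2, step1 v hv z hz⟩) ?_ hz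
        rintro z ⟨hz, hz'⟩ z' ⟨hw, hw'⟩ a b ha hb hab
        have hvt := hv.2
        refine ⟨(convex_halfSpace_gt ψ.isLinear t) hz hw ha hb hab, ?_⟩
        have := smul_add_smul_mem_smul hKc ha hb (by linarith) (by linarith) hz' hw'
        convert this using 1
        · simp only [map_add, map_smul, smul_eq_mul]
          obtain rfl : b = 1 - a := by linarith
          congr 1
          ring
        · simp only [map_add, map_smul, smul_eq_mul]
          obtain rfl : b = 1 - a := by linarith
          module
      have hzt : t < ψ z :=
        convexHull_min (fun v hv => hv.2) (convex_halfSpace_gt ψ.isLinear t) hz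
      have step3 : ψ y ≤ t ∧ (ψ z - t) • y + (t - ψ y) • z ∈ (ψ z - ψ y) • K := by
        refine convexHull_min (t := {y | ψ y ≤ t ∧
          (ψ z - t) • y + (t - ψ y) • z ∈ (ψ z - ψ y) • K})
          (fun v hv => ⟨hv.2, (step2 v hv z hz).2⟩) ?_ hy
        rintro v ⟨hv, hv'⟩ v' ⟨hw, hw'⟩ a b ha hb hab
        refine ⟨(convex_halfSpace_le ψ.isLinear t) hv hw ha hb hab, ?_⟩
        have := smul_add_smul_mem_smul hKc ha hb (by linarith) (by linarith) hv' hw'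
        convert this using 1
        · simp only [map_add, map_smul, smul_eq_mul]
          obtain rfl : b = 1 - a := by linarith
          congr 1
          ring
        · simp only [map_add, map_smul, smul_eq_mul]
          obtain rfl : b = 1 - a := by linarith
          module
      obtain ⟨a, b, ha, hb, hab, rfl⟩ := hxyz
      have hpos : 0 < ψ z - ψ y := by linarith [step3.1]
      obtain ⟨k, hk, hk'⟩ := step3.2
      simp only [map_add, map_smul, smul_eq_mul] at hxt
      convert hk using 1
      apply (smul_right_injective _ hpos.ne')
      dsimp only at hk' ⊢
      rw [hk']
      obtain rfl : b = 1 - a := by linarith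
      subst hxt
      module
    · exact convexHull_min (fun x hx => (Finset.mem_filter.1 hx).2) (convex_slice hPc t)
  refine ⟨W, ?_, key⟩
  rw [key, hK, convexHull_nonempty_iff] at hne
  exact_mod_cast hne

/-! ### Polytopes with integral vertices -/

/-- `P` is the convex hull of a nonempty finite set of points at which `ψ` is integral. -/
def IsIntegralPolytope (ψ : (Fin n → ℝ) →ₗ[ℝ] ℝ) (P : Set (Fin n → ℝ)) : Prop :=
  ∃ s : Finset (Fin n → ℝ), s.Nonempty ∧ (∀ v ∈ s, ∃ k : ℤ, ψ v = k) ∧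
    P = convexHull ℝ (s : Set (Fin n → ℝ))

variable {ψ : (Fin n → ℝ) →ₗ[ℝ] ℝ} {P Q : Set (Fin n → ℝ)}

theorem _root_.IsLatticePolytope.isIntegralPolytope
    (hψ : ∀ z : Fin n → ℤ, ∃ k : ℤ, ψ (fun j => (z j : ℝ)) = k) (hP : IsLatticePolytope P) :
    IsIntegralPolytope ψ P := by
  classical
  obtain ⟨s, hs, rfl⟩ := hP
  refine ⟨s.image fun z j => (z j : ℝ), hs.image _, ?_, by simp⟩
  intro v hv
  obtain ⟨z, -, rfl⟩ := Finset.mem_image.1 hv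
  exact hψ z

namespace IsIntegralPolytope

theorem isPolytope (h : IsIntegralPolytope ψ P) : IsPolytope P := by
  obtain ⟨s, hs, -, rfl⟩ := h
  exact ⟨s, hs, rfl⟩

theorem isCompact (h : IsIntegralPolytope ψ P) : IsCompact P := h.isPolytope.isCompact

theorem convex (h : IsIntegralPolytope ψ P) : Convex ℝ P := h.isPolytope.convex

theorem add (hP : IsIntegralPolytope ψ P) (hQ : IsIntegralPolytope ψ Q) :
    IsIntegralPolytope ψ (P + Q) := by
  classical
  obtain ⟨s, hs, hs', rfl⟩ := hP
  obtain ⟨t, ht, ht', rfl⟩ := hQ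
  refine ⟨s + t, hs.add ht, fun v hv => ?_, ?_⟩
  · obtain ⟨x, hx, y, hy, rfl⟩ := Finset.mem_add.1 hv
    obtain ⟨k, hk⟩ := hs' x hx
    obtain ⟨l, hl⟩ := ht' y hy
    exact ⟨k + l, by simp [hk, hl]⟩
  · rw [Finset.coe_add, convexHull_add]

theorem face (hP : IsIntegralPolytope ψ P) (w : Fin n → ℝ) :
    IsIntegralPolytope ψ (face w P) := by
  have hne := face_nonempty (w := w) hP.isCompact hP.isPolytope.nonempty
  obtain ⟨s, hs, hs', rfl⟩ := hP
  obtain ⟨t, hts, ht⟩ := exists_convexHull_of_isExposed (isExposed_face w _)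
  refine ⟨t, ?_, fun v hv => hs' v (hts hv), ht⟩
  rw [ht] at hne
  simpa using hne

theorem exists_image_eq_Icc (hP : IsIntegralPolytope ψ P) :
    ∃ r s : ℤ, r ≤ s ∧ ψ '' P = Icc (r : ℝ) s := by
  obtain ⟨V, hV, hV', rfl⟩ := hP
  obtain ⟨x, hx, hxm⟩ := V.exists_min_image ψ hV
  obtain ⟨y, hy, hym⟩ := V.exists_max_image ψ hV
  obtain ⟨r, hr⟩ := hV' x hx
  obtain ⟨s, hs⟩ := hV' y hy
  refine ⟨r, s, ?_, ?_⟩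
  · have := hxm y hy
    rw [hr, hs] at this
    exact_mod_cast this
  · apply Subset.antisymm
    · rintro _ ⟨z, hz, rfl⟩
      constructor
      · exact convexHull_min (t := {z | (r : ℝ) ≤ ψ z}) (fun v hv => hr ▸ hxm v hv)
          (convex_halfSpace_ge ψ.isLinear _) hz
      · exact convexHull_min (t := {z | ψ z ≤ (s : ℝ)}) (fun v hv => hs ▸ hym v hv)
          (convex_halfSpace_le ψ.isLinear _) hz
    · have : Convex ℝ (ψ '' convexHull ℝ (V : Set (Fin n → ℝ))) :=
        (convex_convexHull ℝ _).linear_image ψ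
      exact this.ordConnected.out ⟨x, subset_convexHull ℝ _ hx, hr⟩
        ⟨y, subset_convexHull ℝ _ hy, hs⟩

/-- Between two consecutive integral levels, slices interpolate linearly; at the midpoint. -/
theorem slice_add_half (hP : IsIntegralPolytope ψ P) (i : ℤ) :
    slice ψ P (i + 1 / 2) =
      (1 / 2 : ℝ) • slice ψ P i + (1 / 2 : ℝ) • slice ψ P (i + 1 : ℤ) := by
  have hc := hP.convex
  obtain ⟨s, hs, hs', rfl⟩ := hP
  set P := convexHull ℝ (s : Set (Fin n → ℝ)) with hPdef
  apply Subset.antisymm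
  · rintro x ⟨hx, hxt⟩
    have hxt : ψ x = i + 1 / 2 := hxt
    have hlo : convexHull ℝ {v | v ∈ s ∧ ψ v ≤ i} ⊆ {v | ψ v ≤ i} :=
      convexHull_min (fun v hv => hv.2) (convex_halfSpace_le ψ.isLinear _)
    have hhi : convexHull ℝ {v | v ∈ s ∧ (i : ℝ) + 1 ≤ ψ v} ⊆ {v | (i : ℝ) + 1 ≤ ψ v} :=
      convexHull_min (fun v hv => hv.2) (convex_halfSpace_ge ψ.isLinear _)
    -- Integrality leaves no generator with level strictly between `i` and `i + 1`, so the two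
    -- subsets exhaust `s`.
    obtain ⟨y, hy, z, hz, hxyz⟩ := exists_mem_segment_of_union (s := (s : Set (Fin n → ℝ)))
        (s₁ := {v | v ∈ s ∧ ψ v ≤ i}) (s₂ := {v | v ∈ s ∧ (i : ℝ) + 1 ≤ ψ v})
        (fun v hv => by
          obtain ⟨k, hk⟩ := hs' v hv
          rcases le_or_gt k i with h | h
          · exact Or.inl ⟨hv, by rw [hk]; exact_mod_cast h⟩
          · exact Or.inr ⟨hv, by rw [hk]; exact_mod_cast h⟩) hx
        (fun h => by have : ψ x ≤ i := hlo h
                     linarith)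
        (fun h => by have : (i : ℝ) + 1 ≤ ψ x := hhi h
                     linarith)
    have hyl : ψ y ≤ i := hlo hy
    have hzl : (i : ℝ) + 1 ≤ ψ z := hhi hz
    have hyP : y ∈ P := convexHull_mono (fun v hv => hv.1) hy
    have hzP : z ∈ P := convexHull_mono (fun v hv => hv.1) hz
    have hpos : 0 < ψ z - ψ y := by linarith
    obtain ⟨a, b, ha, hb, hab, rfl⟩ := hxyz
    simp only [map_add, map_smul, smul_eq_mul] at hxt
    have hpt : ∀ c : ℝ, ψ y ≤ c → c ≤ ψ z →
        y + ((c - ψ y) / (ψ z - ψ y)) • (z - y) ∈ slice ψ P c := by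
      intro c h1 h2
      refine ⟨hc.add_smul_sub_mem hyP hzP ⟨div_nonneg (by linarith) hpos.le,
        (div_le_one hpos).2 (by linarith)⟩, ?_⟩
      simp only [mem_preimage, mem_singleton_iff, map_add, map_smul, map_sub, smul_eq_mul]
      field_simp
      ring
    refine ⟨_, smul_mem_smul_set (hpt i hyl (by linarith)), _,
      smul_mem_smul_set (hpt (i + 1 : ℤ) (by push_cast; linarith) (by push_cast; linarith)), ?_⟩
    push_cast
    obtain rfl : a = 1 - b := by linarith
    have hb' : b = (i + 1 / 2 - ψ y) / (ψ z - ψ y) := by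
      field_simp
      linarith
    -- The parameter of `x` on the segment from `y` to `z` is the mean of the parameters at levels
    -- `i` and `i + 1`.
    have : b = (1 / 2) * ((i - ψ y) / (ψ z - ψ y)) + (1 / 2) * ((i + 1 - ψ y) / (ψ z - ψ y)) := by
      rw [hb']
      ring
    rw [this]
    module
  · rintro _ ⟨_, ⟨x, hx, rfl⟩, _, ⟨y, hy, rfl⟩, rfl⟩
    refine ⟨hc hx.1 hy.1 (by norm_num) (by norm_num) (by norm_num), ?_⟩
    have h1 : ψ x = i := hx.2
    have h2 : ψ y = (i + 1 : ℤ) := hy.2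
    simp only [mem_preimage, mem_singleton_iff, map_add, map_smul, h1, h2, smul_eq_mul]
    push_cast
    ring

theorem isPolytope_slice (hP : IsIntegralPolytope ψ P) {t : ℝ} (h : t ∈ ψ '' P) :
    IsPolytope (slice ψ P t) :=
  FiberPolytope.isPolytope_slice hP.isPolytope h

/-- The chord of the support function of slices over `[i, i + 1]` bounds it everywhere. -/
theorem le_chord (hP : IsIntegralPolytope ψ P) {i : ℤ} (hi : (slice ψ P i).Nonempty)
    (hi' : (slice ψ P (i + 1 : ℤ)).Nonempty) (u : (Fin n → ℝ) →L[ℝ] ℝ) {x : Fin n → ℝ}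
    (hx : x ∈ P) :
    u x ≤ supp u (slice ψ P i) +
      (supp u (slice ψ P (i + 1 : ℤ)) - supp u (slice ψ P i)) * (ψ x - i) := by
  have hc := hP.convex
  have hcomp := hP.isCompact
  obtain ⟨p, hp, hpα⟩ := exists_eq_supp (isCompact_slice hcomp _) hi u
  obtain ⟨q, hq, hqα⟩ := exists_eq_supp (isCompact_slice hcomp _) hi' u
  have hle : ∀ z ∈ slice ψ P i, u z ≤ supp u (slice ψ P i) :=
    fun z hz => le_supp (isCompact_slice hcomp _) u hz
  have hle' : ∀ z ∈ slice ψ P (i + 1 : ℤ), u z ≤ supp u (slice ψ P (i + 1 : ℤ)) :=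
    fun z hz => le_supp (isCompact_slice hcomp _) u hz
  set α := supp u (slice ψ P i)
  set β := supp u (slice ψ P (i + 1 : ℤ))
  have hpi : ψ p = i := hp.2
  have hqi : ψ q = (i : ℝ) + 1 := by
    have : ψ q = (i + 1 : ℤ) := hq.2
    rw [this]
    push_cast
    rfl
  obtain ⟨s, hs, hs', rfl⟩ := hP
  have hcv : Convex ℝ {x : Fin n → ℝ | u x - (β - α) * ψ x ≤ α - (β - α) * i} :=
    convex_halfSpace_le (f := fun x => u x - (β - α) * ψ x)
      (u.toLinearMap - (β - α) • ψ).isLinear _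
  have : x ∈ {x : Fin n → ℝ | u x - (β - α) * ψ x ≤ α - (β - α) * i} := by
    refine convexHull_min (fun v hv => ?_) hcv hx
    have hvP := subset_convexHull ℝ _ hv
    obtain ⟨k, hk⟩ := hs' v hv
    simp only [mem_ofPred_eq]
    -- A generator has level at most `i` or at least `i + 1`. In the first case, the segment from it
    -- to the maximizer `q` at level `i + 1` crosses level `i`, where the value is at most `α`;
    -- extrapolating gives the chord bound. The second case uses `p` and level `i + 1` in the same
    -- way.
    rcases le_or_gt k i with h | h
    · have hki : (k : ℝ) ≤ i := by exact_mod_cast h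
      have hpos : (0 : ℝ) < i + 1 - k := by linarith
      have := hle (q + (1 / (i + 1 - k : ℝ)) • (v - q)) ⟨hc.add_smul_sub_mem hq.1 hvP
        ⟨by positivity, (div_le_one hpos).2 (by linarith)⟩, by
          simp only [mem_preimage, mem_singleton_iff, map_add, map_smul, map_sub, smul_eq_mul,
            hqi, hk]
          field_simp
          ring⟩
      simp only [map_add, map_smul, map_sub, smul_eq_mul, hqα] at this
      have h2 : (u v - β) / (i + 1 - k) ≤ α - β := by
        rw [div_eq_inv_mul, ← one_div]
        linarith
      rw [div_le_iff₀ hpos] at h2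
      rw [hk]
      linarith
    · have hki : (i : ℝ) + 1 ≤ k := by exact_mod_cast h
      have hpos : (0 : ℝ) < k - i := by linarith
      have := hle' (p + (1 / (k - i : ℝ)) • (v - p)) ⟨hc.add_smul_sub_mem hp.1 hvP
        ⟨by positivity, (div_le_one hpos).2 (by linarith)⟩, by
          simp only [mem_preimage, mem_singleton_iff, map_add, map_smul, map_sub, smul_eq_mul,
            hpi, hk]
          push_cast
          field_simp⟩
      simp only [map_add, map_smul, map_sub, smul_eq_mul, hpα] at this
      have h2 : (u v - α) / (k - i) ≤ β - α := by
        rw [div_eq_inv_mul, ← one_div]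
        linarith
      rw [div_le_iff₀ hpos] at h2
      rw [hk]
      linarith
  have h : u x - (β - α) * ψ x ≤ α - (β - α) * i := this
  linarith

end IsIntegralPolytope

end

/-! ### Fiber polytopes of integral polytopes -/

/-- An integral polytope on which the range of `ψ` is `[r, s]`. -/
structure HasRange (ψ : (Fin n → ℝ) →ₗ[ℝ] ℝ) (P : Set (Fin n → ℝ)) (r s : ℤ) : Prop where
  integral : IsIntegralPolytope ψ P
  image_eq : ψ '' P = Icc (r : ℝ) s

/-- The Minkowski sum of the slices at levels `i + 1/2, …, i + p - 1/2`. -/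
def midSum (ψ : (Fin n → ℝ) →ₗ[ℝ] ℝ) (P : Set (Fin n → ℝ)) : ℕ → ℤ → Set (Fin n → ℝ)
  | 0, _ => {0}
  | p + 1, i => slice ψ P (i + 1 / 2) + midSum ψ P p (i + 1)

/-- The convex hull of the union, over all monotone lattice paths from `(i, j)` to
`(i + p, j + q)`, of the Minkowski sum of the slices of `D` at the heights of the horizontal
steps and of the slices of `C` at the abscissae of the vertical steps. -/
def pathHull (ψ : (Fin n → ℝ) →ₗ[ℝ] ℝ) (C D : Set (Fin n → ℝ)) :
    ℕ → ℕ → ℤ → ℤ → Set (Fin n → ℝ)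
  | 0, 0, _, _ => {0}
  | p + 1, 0, i, j => slice ψ D j + pathHull ψ C D p 0 (i + 1) j
  | 0, q + 1, i, j => slice ψ C i + pathHull ψ C D 0 q i (j + 1)
  | p + 1, q + 1, i, j => convexHull ℝ ((slice ψ D j + pathHull ψ C D p (q + 1) (i + 1) j) ∪
      (slice ψ C i + pathHull ψ C D (p + 1) q i (j + 1)))

variable {ψ : (Fin n → ℝ) →ₗ[ℝ] ℝ} {P C D : Set (Fin n → ℝ)} {r s r' s' : ℤ}

theorem HasRange.slice_nonempty (h : HasRange ψ P r s) {t : ℝ} (h1 : r ≤ t) (h2 : t ≤ s) :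
    (slice ψ P t).Nonempty := by
  rw [image_nonempty_slice, h.image_eq]
  exact ⟨h1, h2⟩

theorem HasRange.isPolytope_slice (h : HasRange ψ P r s) {t : ℝ} (h1 : r ≤ t) (h2 : t ≤ s) :
    IsPolytope (slice ψ P t) :=
  FiberPolytope.isPolytope_slice h.integral.isPolytope (h.slice_nonempty h1 h2)

theorem HasRange.isPolytope_half (h : HasRange ψ P r s) {i : ℤ} (h1 : r ≤ i) (h2 : i + 1 ≤ s) :
    IsPolytope (slice ψ P (i + 1 / 2)) := by
  have h1' : (r : ℝ) ≤ i := by exact_mod_cast h1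
  have h2' : (i : ℝ) + 1 ≤ s := by exact_mod_cast h2
  exact h.isPolytope_slice (by linarith) (by linarith)

theorem HasRange.isPolytope_int (h : HasRange ψ P r s) {i : ℤ} (h1 : r ≤ i) (h2 : i ≤ s) :
    IsPolytope (slice ψ P i) :=
  h.isPolytope_slice (by exact_mod_cast h1) (by exact_mod_cast h2)

theorem HasRange.supp_half (h : HasRange ψ P r s) {i : ℤ} (h1 : r ≤ i) (h2 : i + 1 ≤ s)
    (u : (Fin n → ℝ) →L[ℝ] ℝ) : supp u (slice ψ P (i + 1 / 2)) =
      (supp u (slice ψ P i) + supp u (slice ψ P (i + 1 : ℤ))) / 2 := by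
  rw [h.integral.slice_add_half, ((h.isPolytope_int h1 (by omega)).smul _).supp_add
    ((h.isPolytope_int (by omega) h2).smul _), supp_smul _ (by norm_num),
    supp_smul _ (by norm_num)]
  ring

theorem HasRange.isPolytope_midSum (h : HasRange ψ P r s) :
    ∀ (p : ℕ) (i : ℤ), r ≤ i → i + p = s → IsPolytope (midSum ψ P p i)
  | 0, _, _, _ => isPolytope_singleton_zero
  | p + 1, i, hi, hp => by
    push_cast at hp
    exact (h.isPolytope_half hi (by omega)).add
      (h.isPolytope_midSum p (i + 1) (by omega) (by omega))

theorem midSum_eq_sum : ∀ (p : ℕ) (i s : ℤ), i + p = s →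
    midSum ψ P p i = ∑ k ∈ Finset.Ico i s, slice ψ P (k + 1 / 2)
  | 0, i, s, h => by
    obtain rfl : i = s := by simpa using h
    simp [midSum, Set.singleton_zero]
  | p + 1, i, s, h => by
    push_cast at h
    have : Finset.Ico i s = insert i (Finset.Ico (i + 1) s) := by
      ext k
      simp only [Finset.mem_insert, Finset.mem_Ico]
      omega
    rw [midSum, midSum_eq_sum p (i + 1) s (by omega), this, Finset.sum_insert (by simp)]

/-- The mean of a section lies in the middle slice; conversely, linear sections realize every
midpoint of points in the two end slices, and these midpoints fill the middle slice. -/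
theorem IsIntegralPolytope.secInt_unit (h : IsIntegralPolytope ψ P) (i : ℤ) :
    secInt ψ P i (i + 1 : ℤ) = slice ψ P (i + 1 / 2) := by
  apply Subset.antisymm
  · have := secInt_subset_smul_slice (ψ := ψ) h.convex h.isCompact.isClosed
      (s := i) (t := (i + 1 : ℤ)) (by simp)
    push_cast at this ⊢
    rw [add_sub_cancel_left, one_smul] at this
    convert this using 2
    ring
  · rw [h.slice_add_half]
    rintro _ ⟨_, ⟨x, hx, rfl⟩, _, ⟨y, hy, rfl⟩, rfl⟩
    have := smul_midpoint_mem_secInt h.convex (by simp) hx hy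
    push_cast at this
    rw [add_sub_cancel_left, one_smul] at this
    push_cast
    exact this

theorem HasRange.secInt_eq_midSum (h : HasRange ψ P r s) :
    ∀ (p : ℕ) (i : ℤ), r ≤ i → i + p = s → secInt ψ P i s = midSum ψ P p i
  | 0, i, hi, hp => by
    obtain rfl : i = s := by simpa using hp
    exact secInt_self (h.isPolytope_int hi le_rfl).nonempty
  | p + 1, i, hi, hp => by
    push_cast at hp
    have h1 : (i : ℝ) ≤ (i + 1 : ℤ) := by simp
    have h2 : ((i + 1 : ℤ) : ℝ) ≤ s := by
      have : i + 1 ≤ s := by omega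
      exact_mod_cast this
    rw [midSum, ← secInt_add h1 h2, h.secInt_eq_midSum p (i + 1) (by omega) (by omega),
      h.integral.secInt_unit]

theorem HasRange.fiberPolytope_eq (h : HasRange ψ P r s) {p : ℕ} (hp : r + p = s) :
    fiberPolytope ψ P = midSum ψ P p r := by
  rw [fiberPolytope_eq_secInt h.image_eq, h.secInt_eq_midSum p r le_rfl hp]

/-! ### The hull over lattice paths -/

/-- Transposing the lattice exchanges horizontal and vertical steps. This lets each vertical step be
treated as a horizontal one. -/
theorem pathHull_comm (ψ : (Fin n → ℝ) →ₗ[ℝ] ℝ) (C D : Set (Fin n → ℝ)) :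
    ∀ (p q : ℕ) (i j : ℤ), pathHull ψ C D p q i j = pathHull ψ D C q p j i
  | 0, 0, _, _ => by simp only [pathHull]
  | p + 1, 0, i, j => by rw [pathHull, pathHull, pathHull_comm ψ C D p 0]
  | 0, q + 1, i, j => by rw [pathHull, pathHull, pathHull_comm ψ C D 0 q]
  | p + 1, q + 1, i, j => by
    rw [pathHull, pathHull, pathHull_comm ψ C D p (q + 1), pathHull_comm ψ C D (p + 1) q,
      union_comm]

theorem isPolytope_pathHull (hC : HasRange ψ C r s) (hD : HasRange ψ D r' s') :
    ∀ (p q : ℕ) (i j : ℤ), r ≤ i → i + p = s → r' ≤ j → j + q = s' →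
      IsPolytope (pathHull ψ C D p q i j)
  | 0, 0, _, _, _, _, _, _ => by
    rw [pathHull]
    exact isPolytope_singleton_zero
  | p + 1, 0, i, j, hi, hp, hj, hq => by
    rw [pathHull]
    push_cast at hp
    exact (hD.isPolytope_int hj (by omega)).add
      (isPolytope_pathHull hC hD p 0 (i + 1) j (by omega) (by omega) hj hq)
  | 0, q + 1, i, j, hi, hp, hj, hq => by
    rw [pathHull]
    push_cast at hq
    exact (hC.isPolytope_int hi (by omega)).add
      (isPolytope_pathHull hC hD 0 q i (j + 1) hi hp (by omega) (by omega))
  | p + 1, q + 1, i, j, hi, hp, hj, hq => by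
    rw [pathHull]
    exact ((hD.isPolytope_int hj (by omega)).add
      (isPolytope_pathHull hC hD p (q + 1) (i + 1) j (by omega) (by push_cast at hp; omega)
        hj hq)).convexHull_union
      ((hC.isPolytope_int hi (by omega)).add
      (isPolytope_pathHull hC hD (p + 1) q i (j + 1) hi hp (by omega) (by push_cast at hq; omega)))

/-! ### Lattice paths give integrals of sections. -/

theorem add_subset_pathHull (ψ : (Fin n → ℝ) →ₗ[ℝ] ℝ) (C D : Set (Fin n → ℝ)) (p q : ℕ)
    (i j : ℤ) : slice ψ D j + pathHull ψ C D p q (i + 1) j ⊆ pathHull ψ C D (p + 1) q i j := by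
  cases q with
  | zero => rw [pathHull.eq_2]
  | succ q =>
    rw [pathHull.eq_4]
    exact subset_union_left.trans (subset_convexHull ℝ _)

/-- The contribution of a horizontal step of a path. -/
theorem step_mem_secInt (hC : IsIntegralPolytope ψ C) (hDc : Convex ℝ D) {a b : ℝ} (ha : 0 < a)
    {i j : ℤ} {c d : Fin n → ℝ} (hc : c ∈ slice ψ C (i + 1 / 2)) (hd : d ∈ slice ψ D j) :
    a ^ 2 • c + (a * b) • d ∈
      secInt ψ (a • C + b • D) (a * i + b * j) (a * (i + 1 : ℤ) + b * j) := by
  rw [hC.slice_add_half] at hc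
  obtain ⟨_, ⟨x, hx, rfl⟩, _, ⟨y, hy, rfl⟩, rfl⟩ := hc
  have hd2 : ψ d = j := hd.2
  have key : ∀ t : ℝ, ∀ z ∈ slice ψ C t, a • z + b • d ∈ slice ψ (a • C + b • D)
      (a * t + b * j) := fun t z hz =>
    ⟨add_mem_add (smul_mem_smul_set hz.1) (smul_mem_smul_set hd.1), by
      have : ψ z = t := hz.2
      simp [this, hd2]⟩
  have := smul_midpoint_mem_secInt ((hC.convex.smul a).add (hDc.smul b))
    (by push_cast; linarith) (key _ x hx) (key _ y hy)
  -- The interval has length `a` and the mean value of the section is `a • c + b • d`, whence the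
  -- coefficients `a ^ 2` and `a * b`.
  convert this using 1
  push_cast
  module

theorem sum_mem_secInt (hC : HasRange ψ C r s) (hD : HasRange ψ D r' s') {a b : ℝ} (ha : 0 < a)
    (hb : 0 < b) :
    ∀ (p q : ℕ) (i j : ℤ), r ≤ i → i + p = s → r' ≤ j → j + q = s' →
      ∀ x ∈ midSum ψ C p i, ∀ y ∈ pathHull ψ C D p q i j, ∀ z ∈ midSum ψ D q j,
        a ^ 2 • x + (a * b) • y + b ^ 2 • z ∈
          secInt ψ (a • C + b • D) (a * i + b * j) (a * s + b * s') := by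
  have horizontal : ∀ (p q : ℕ) (i j : ℤ), r ≤ i → i + (p + 1 : ℕ) = s → r' ≤ j → j + q = s' →
      (∀ x ∈ midSum ψ C p (i + 1), ∀ y ∈ pathHull ψ C D p q (i + 1) j, ∀ z ∈ midSum ψ D q j,
        a ^ 2 • x + (a * b) • y + b ^ 2 • z ∈
          secInt ψ (a • C + b • D) (a * (i + 1 : ℤ) + b * j) (a * s + b * s')) →
      ∀ x ∈ midSum ψ C (p + 1) i, ∀ y ∈ slice ψ D j + pathHull ψ C D p q (i + 1) j,
        ∀ z ∈ midSum ψ D q j, a ^ 2 • x + (a * b) • y + b ^ 2 • z ∈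
          secInt ψ (a • C + b • D) (a * i + b * j) (a * s + b * s') := by
    rintro p q i j hi hp hj hq ih _ ⟨c, hc, x, hx, rfl⟩ _ ⟨d, hd, y, hy, rfl⟩ z hz
    push_cast at hp
    have h1 : ((i + 1 : ℤ) : ℝ) ≤ s := by exact_mod_cast (by omega : i + 1 ≤ s)
    have h2 : (j : ℝ) ≤ s' := by exact_mod_cast (by omega : j ≤ s')
    have h3 : (i : ℝ) ≤ (i + 1 : ℤ) := by simp
    rw [← secInt_add (t := a * (i + 1 : ℤ) + b * j) (by gcongr) (by gcongr)]
    refine ⟨_, step_mem_secInt (b := b) hC.integral hD.integral.convex ha hc hd, _,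
      ih x hx y hy z hz, ?_⟩
    dsimp only
    module
  have vertical : ∀ (p q : ℕ) (i j : ℤ), r ≤ i → i + p = s → r' ≤ j → j + (q + 1 : ℕ) = s' →
      (∀ x ∈ midSum ψ C p i, ∀ y ∈ pathHull ψ C D p q i (j + 1), ∀ z ∈ midSum ψ D q (j + 1),
        a ^ 2 • x + (a * b) • y + b ^ 2 • z ∈
          secInt ψ (a • C + b • D) (a * i + b * (j + 1 : ℤ)) (a * s + b * s')) →
      ∀ x ∈ midSum ψ C p i, ∀ y ∈ slice ψ C i + pathHull ψ C D p q i (j + 1),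
        ∀ z ∈ midSum ψ D (q + 1) j, a ^ 2 • x + (a * b) • y + b ^ 2 • z ∈
          secInt ψ (a • C + b • D) (a * i + b * j) (a * s + b * s') := by
    rintro p q i j hi hp hj hq ih x hx _ ⟨c, hc, y, hy, rfl⟩ _ ⟨d, hd, z, hz, rfl⟩
    push_cast at hq
    have h1 : ((j + 1 : ℤ) : ℝ) ≤ s' := by exact_mod_cast (by omega : j + 1 ≤ s')
    have h2 : (i : ℝ) ≤ s := by exact_mod_cast (by omega : i ≤ s)
    have h3 : (j : ℝ) ≤ (j + 1 : ℤ) := by simp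
    rw [← secInt_add (t := a * i + b * (j + 1 : ℤ)) (by gcongr) (by gcongr)]
    have := step_mem_secInt (b := a) hD.integral hC.integral.convex hb hd hc
    rw [add_comm (b • D), add_comm (b * (j : ℝ)), add_comm (b * ((j + 1 : ℤ) : ℝ))] at this
    refine ⟨_, this, _, ih x hx y hy z hz, ?_⟩
    dsimp only
    module
  intro p q
  induction hN : p + q generalizing p q with
  | zero =>
    intro i j hi hp hj hq
    obtain ⟨rfl, rfl⟩ : p = 0 ∧ q = 0 := by omega
    obtain rfl : i = s := by simpa using hp
    obtain rfl : j = s' := by simpa using hq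
    rw [secInt_self, pathHull]
    · simp [midSum]
    · obtain ⟨x, hx, hx'⟩ := (hC.isPolytope_int hi le_rfl).nonempty
      obtain ⟨y, hy, hy'⟩ := (hD.isPolytope_int hj le_rfl).nonempty
      have hx' : ψ x = i := hx'
      have hy' : ψ y = j := hy'
      exact ⟨a • x + b • y, add_mem_add (smul_mem_smul_set hx) (smul_mem_smul_set hy),
        by simp [hx', hy']⟩
  | succ N ih =>
    intro i j hi hp hj hq
    have hH : ∀ p', p = p' + 1 → ∀ x ∈ midSum ψ C p i,
        ∀ y ∈ slice ψ D j + pathHull ψ C D p' q (i + 1) j,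
        ∀ z ∈ midSum ψ D q j, a ^ 2 • x + (a * b) • y + b ^ 2 • z ∈
          secInt ψ (a • C + b • D) (a * i + b * j) (a * s + b * s') := by
      rintro p' rfl
      exact horizontal p' q i j hi hp hj hq
        (ih p' q (by omega) (i + 1) j (by omega) (by push_cast at hp; omega) hj hq)
    have hV : ∀ q', q = q' + 1 → ∀ x ∈ midSum ψ C p i,
        ∀ y ∈ slice ψ C i + pathHull ψ C D p q' i (j + 1),
        ∀ z ∈ midSum ψ D q j, a ^ 2 • x + (a * b) • y + b ^ 2 • z ∈
          secInt ψ (a • C + b • D) (a * i + b * j) (a * s + b * s') := by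
      rintro q' rfl
      exact vertical p q' i j hi hp hj hq
        (ih p q' (by omega) i (j + 1) hi hp (by omega) (by push_cast at hq; omega))
    rcases p with _ | p <;> rcases q with _ | q
    · omega
    · rw [pathHull]
      exact hV q rfl
    · rw [pathHull]
      exact hH p rfl
    · rw [pathHull]
      intro x hx y hy z hz
      -- For fixed `x` and `z` the admissible `y` form a convex set, so the two possible first steps
      -- suffice for their hull.
      have hcv : Convex ℝ {y | a ^ 2 • x + (a * b) • y + b ^ 2 • z ∈
          secInt ψ (a • C + b • D) (a * i + b * j) (a * s + b * s')} := by
        intro y₁ h₁ y₂ h₂ α β hα hβ hαβ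
        have := convex_secInt ψ ((hC.integral.convex.smul a).add (hD.integral.convex.smul b)) _ _
          h₁ h₂ hα hβ hαβ
        obtain rfl : β = 1 - α := by linarith
        simp only [mem_ofPred_eq]
        convert this using 1
        module
      exact convexHull_min (union_subset (fun y hy => hH p rfl x hx y hy z hz)
        (fun y hy => hV q rfl x hx y hy z hz)) hcv hy

/-! ### Integrals of sections are bounded by the greedy path. -/

/-- As long as one of the `p` remaining unit steps in `C` from level `i` is available, the slope
over `[i, i + 1]` of the support function of the slices of `C` bounds that of `D` to the left
of `j`. -/
def SlopeBound (ψ : (Fin n → ℝ) →ₗ[ℝ] ℝ) (u : (Fin n → ℝ) →L[ℝ] ℝ) (C D : Set (Fin n → ℝ))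
    (p : ℕ) (i j : ℤ) : Prop :=
  0 < p → ∀ x ∈ D, ψ x ≤ j → u x ≤ supp u (slice ψ D j) +
    (supp u (slice ψ C (i + 1 : ℤ)) - supp u (slice ψ C i)) * (ψ x - j)

/-- The integrals of the sections of `a • C + b • D` are bounded by the path hull. -/
def PathBound (ψ : (Fin n → ℝ) →ₗ[ℝ] ℝ) (u : (Fin n → ℝ) →L[ℝ] ℝ) (C D : Set (Fin n → ℝ))
    (a b : ℝ) (p q : ℕ) (i j : ℤ) : Prop :=
  ∀ y ∈ secInt ψ (a • C + b • D) (a * i + b * j) (a * (i + p : ℤ) + b * (j + q : ℤ)),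
    u y ≤ a ^ 2 * supp u (midSum ψ C p i) + (a * b) * supp u (pathHull ψ C D p q i j) +
      b ^ 2 * supp u (midSum ψ D q j)

theorem PathBound.symm {u : (Fin n → ℝ) →L[ℝ] ℝ} {a b : ℝ} {p q : ℕ} {i j : ℤ}
    (h : PathBound ψ u C D a b p q i j) : PathBound ψ u D C b a q p j i := by
  intro y hy
  rw [add_comm (b • D), add_comm (b * (j : ℝ)), add_comm (b * ((j + q : ℤ) : ℝ))] at hy
  have := h y hy
  rw [pathHull_comm] at this
  linarith

/-- The points of `C` and of `D` obey affine bounds in `ψ` with the same slope. In the weighted sum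
of these bounds only the total level `a * ψ c + b * ψ d` remains, and it is fixed at the midpoint of
the step. -/
theorem step_le (hC : HasRange ψ C r s) (hD : HasRange ψ D r' s') {a b : ℝ}
    (ha : 0 < a) (hb : 0 < b) {i j : ℤ} (hi : r ≤ i) (hi' : i + 1 ≤ s)
    {u : (Fin n → ℝ) →L[ℝ] ℝ}
    (hd : ∀ d ∈ D, u d ≤ supp u (slice ψ D j) +
      (supp u (slice ψ C (i + 1 : ℤ)) - supp u (slice ψ C i)) * (ψ d - j))
    {y : Fin n → ℝ}
    (hy : y ∈ secInt ψ (a • C + b • D) (a * i + b * j) (a * (i + 1 : ℤ) + b * j)) :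
    u y ≤ a ^ 2 * supp u (slice ψ C (i + 1 / 2)) + (a * b) * supp u (slice ψ D j) := by
  have hpol := (hC.integral.isPolytope.smul a).add (hD.integral.isPolytope.smul b)
  obtain ⟨_, ⟨⟨_, ⟨c, hc, rfl⟩, _, ⟨d, hdD, rfl⟩, rfl⟩, hm⟩, rfl⟩ :=
    secInt_subset_smul_slice hpol.convex hpol.isCompact.isClosed (by push_cast; linarith) hy
  have hlvl : a * (ψ c - i) + b * (ψ d - j) = a / 2 := by
    simp only [mem_preimage, map_add, map_smul, smul_eq_mul, mem_singleton_iff] at hm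
    push_cast at hm
    linarith
  have h1 := hC.integral.le_chord (hC.isPolytope_int hi (by omega)).nonempty
    (hC.isPolytope_int (by omega) hi').nonempty u hc
  have h2 := hd d hdD
  rw [hC.supp_half hi hi']
  set α := supp u (slice ψ C i)
  set α' := supp u (slice ψ C (i + 1 : ℤ))
  set β := supp u (slice ψ D j)
  have e1 : u ((a * ((i + 1 : ℤ) : ℝ) + b * j - (a * i + b * j)) • (a • c + b • d)) =
      a * (a * u c + b * u d) := by
    simp only [map_smul, map_add, smul_eq_mul]
    push_cast
    ring
  have h3 : a * u c + b * u d ≤ a * (α + α') / 2 + b * β := by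
    have := mul_le_mul_of_nonneg_left h1 ha.le
    have := mul_le_mul_of_nonneg_left h2 hb.le
    have e2 : (α' - α) * (a * (ψ c - i) + b * (ψ d - j)) = (α' - α) * (a / 2) := by rw [hlvl]
    linarith
  calc u _ = a * (a * u c + b * u d) := e1
    _ ≤ a * (a * (α + α') / 2 + b * β) := mul_le_mul_of_nonneg_left h3 ha.le
    _ = _ := by ring

/-- A horizontal step is optimal if the next slope for `C` is at least the next slope for `D`. -/
theorem pathBound_succ (hC : HasRange ψ C r s) (hD : HasRange ψ D r' s') {a b : ℝ}
    (ha : 0 < a) (hb : 0 < b) {p q : ℕ} {i j : ℤ} (hi : r ≤ i) (hp : i + (p + 1 : ℕ) = s)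
    (hj : r' ≤ j) (hq : j + q = s') {u : (Fin n → ℝ) →L[ℝ] ℝ}
    (hinv : SlopeBound ψ u C D (p + 1) i j)
    (hslope : 0 < q → supp u (slice ψ D (j + 1 : ℤ)) - supp u (slice ψ D j) ≤
      supp u (slice ψ C (i + 1 : ℤ)) - supp u (slice ψ C i))
    (ih : SlopeBound ψ u C D p (i + 1) j → SlopeBound ψ u D C q j (i + 1) →
      PathBound ψ u C D a b p q (i + 1) j) :
    PathBound ψ u C D a b (p + 1) q i j := by
  push_cast at hp
  have hCi := hC.isPolytope_int hi (by omega)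
  have hCi' := hC.isPolytope_int (i := i + 1) (by omega) (by omega)
  have hDj := hD.isPolytope_int hj (by omega)
  have hchord : ∀ x ∈ C, _ := fun x hx =>
    hC.integral.le_chord (i := i) hCi.nonempty hCi'.nonempty u hx
  have ih' : PathBound ψ u C D a b p q (i + 1) j := by
    -- The first invariant persists because the slopes for `C` decrease (concavity) and `ψ x - j ≤
    -- 0`. The second holds because the chord of `C` just used has slope at least the next slope for
    -- `D`.
    refine ih (fun hp0 x hx hxj => ?_) (fun hq0 x hx hxi => ?_)
    · have hCi'' := hC.isPolytope_int (i := i + 1 + 1) (by omega) (by omega)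
      obtain ⟨z, hz, hzu⟩ := exists_eq_supp hCi''.isCompact hCi''.nonempty u
      have h1 := hchord z hz.1
      have hzi : ψ z = i + 1 + 1 := by
        have : ψ z = (i + 1 + 1 : ℤ) := hz.2
        rw [this]
        push_cast
        rfl
      rw [hzu, hzi] at h1
      have h2 := hinv (by omega) x hx hxj
      refine h2.trans ?_
      have := mul_le_mul_of_nonpos_right (c := ψ x - j)
        (by linarith : supp u (slice ψ C (i + 1 + 1 : ℤ)) - supp u (slice ψ C (i + 1 : ℤ)) ≤
          supp u (slice ψ C (i + 1 : ℤ)) - supp u (slice ψ C i)) (by linarith)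
      linarith
    · have h1 := hchord x hx
      have h2 := hslope hq0
      have := mul_le_mul_of_nonpos_right (c := ψ x - (i + 1 : ℤ)) h2 (by linarith)
      push_cast at this h1 ⊢
      linarith
  -- The slope for `C` supports `D` at level `j` from both sides: the invariant covers the left, and
  -- the comparison with the next chord of `D` covers the right. If `q = 0`, level `j` is the top of
  -- `D`.
  have hd : ∀ d ∈ D, u d ≤ supp u (slice ψ D j) +
      (supp u (slice ψ C (i + 1 : ℤ)) - supp u (slice ψ C i)) * (ψ d - j) := by
    intro d hdD
    rcases le_total (ψ d) j with h | h
    · exact hinv (by omega) d hdD h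
    rcases Nat.eq_zero_or_pos q with rfl | hq0
    · have h2 : ψ d ∈ Icc (r' : ℝ) s' := hD.image_eq ▸ mem_image_of_mem ψ hdD
      obtain rfl : j = s' := by simpa using hq
      have h3 : ψ d = j := le_antisymm h2.2 h
      have := le_supp hDj.isCompact u (x := d) ⟨hdD, h3⟩
      rw [h3]
      linarith
    · have h1 := hD.integral.le_chord (i := j) hDj.nonempty
        (hD.isPolytope_int (by omega) (by omega)).nonempty u hdD
      have := mul_le_mul_of_nonneg_right (a := ψ d - j) (hslope hq0) (by linarith)
      linarith
  intro y hy
  have e : (i + (p + 1 : ℕ) : ℤ) = i + 1 + p := by push_cast; ring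
  have h1 : ((i + 1 : ℤ) : ℝ) ≤ (i + 1 + p : ℤ) := by exact_mod_cast (by omega)
  have h2 : (j : ℝ) ≤ (j + q : ℤ) := by exact_mod_cast (by omega)
  have h3 : (i : ℝ) ≤ (i + 1 : ℤ) := by simp
  rw [e, ← secInt_add (t := a * (i + 1 : ℤ) + b * j) (by gcongr) (by gcongr)] at hy
  obtain ⟨y₁, hy₁, y₂, hy₂, rfl⟩ := hy
  have b1 := step_le hC hD ha hb hi (by omega) hd hy₁
  have b2 := ih' y₂ hy₂
  have hpath := isPolytope_pathHull hC hD p q (i + 1) j (by omega) (by omega) hj hq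
  have b3 : supp u (slice ψ D j) + supp u (pathHull ψ C D p q (i + 1) j) ≤
      supp u (pathHull ψ C D (p + 1) q i j) := by
    rw [← hDj.supp_add hpath]
    exact supp_mono (isPolytope_pathHull hC hD (p + 1) q i j hi (by push_cast; omega) hj
      hq).isCompact (hDj.add hpath).nonempty (add_subset_pathHull ψ C D p q i j) u
  have b4 : supp u (midSum ψ C (p + 1) i) =
      supp u (slice ψ C (i + 1 / 2)) + supp u (midSum ψ C p (i + 1)) := by
    rw [midSum, (hC.isPolytope_half hi (by omega)).supp_add
      (hC.isPolytope_midSum p (i + 1) (by omega) (by omega))]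
  have b5 := mul_le_mul_of_nonneg_left b3 (mul_pos ha hb).le
  rw [b4]
  dsimp only
  rw [map_add]
  linarith

/-- Greedy merging of two decreasing sequences of slopes. Quantifying over `C` and `D` inside the
induction allows a vertical step to be handled by exchanging their roles. -/
theorem pathBound (N : ℕ) : ∀ (C D : Set (Fin n → ℝ)) (r s r' s' : ℤ), HasRange ψ C r s →
    HasRange ψ D r' s' → ∀ (a b : ℝ), 0 < a → 0 < b → ∀ (p q : ℕ) (i j : ℤ), p + q = N →
    r ≤ i → i + p = s → r' ≤ j → j + q = s' → ∀ u : (Fin n → ℝ) →L[ℝ] ℝ,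
    SlopeBound ψ u C D p i j → SlopeBound ψ u D C q j i → PathBound ψ u C D a b p q i j := by
  induction N with
  | zero =>
    intro C D r s r' s' hC hD a b ha hb p q i j hN hi hp hj hq u h1 h2
    obtain ⟨rfl, rfl⟩ : p = 0 ∧ q = 0 := by omega
    rintro y ⟨γ, -, -, rfl⟩
    simp [midSum, pathHull]
  | succ N ih =>
    intro C D r s r' s' hC hD a b ha hb p q i j hN hi hp hj hq u h1 h2
    by_cases hH : 0 < p ∧ (0 < q → supp u (slice ψ D (j + 1 : ℤ)) - supp u (slice ψ D j) ≤
      supp u (slice ψ C (i + 1 : ℤ)) - supp u (slice ψ C i))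
    · obtain ⟨p, rfl⟩ : ∃ p', p = p' + 1 := ⟨p - 1, by omega⟩
      exact pathBound_succ hC hD ha hb hi hp hj hq h1 hH.2
        (ih C D r s r' s' hC hD a b ha hb p q (i + 1) j (by omega) (by omega)
          (by push_cast at hp; omega) hj hq u)
    · have hq0 : 0 < q := by
        by_contra h
        exact hH ⟨by omega, fun h' => absurd h' h⟩
      have hsl : 0 < p → supp u (slice ψ C (i + 1 : ℤ)) - supp u (slice ψ C i) ≤
          supp u (slice ψ D (j + 1 : ℤ)) - supp u (slice ψ D j) := by
        intro hp0
        by_contra h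
        exact hH ⟨hp0, fun _ => (not_le.1 h).le⟩
      obtain ⟨q, rfl⟩ : ∃ q', q = q' + 1 := ⟨q - 1, by omega⟩
      exact (pathBound_succ hD hC hb ha hj hq hi hp h2 hsl
        (ih D C r' s' r s hD hC b a hb ha q p (j + 1) i (by omega) (by omega)
          (by push_cast at hq; omega) hi hp u)).symm

/-- At the bottom level no point of `D` lies strictly to the left, so the invariant starts out
trivially. -/
theorem slopeBound_left (C : Set (Fin n → ℝ)) (hD : HasRange ψ D r s) (h : r ≤ s)
    (u : (Fin n → ℝ) →L[ℝ] ℝ) (p : ℕ) (i : ℤ) : SlopeBound ψ u C D p i r := by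
  intro _ x hx hxr
  have h2 : ψ x ∈ Icc (r : ℝ) s := hD.image_eq ▸ mem_image_of_mem ψ hx
  have h3 : ψ x = r := le_antisymm hxr h2.1
  have := le_supp (hD.isPolytope_int le_rfl h).isCompact u (x := x) ⟨hx, h3⟩
  rw [h3]
  linarith

/-! ### Mixed fiber polytopes -/

theorem image_smul_add_smul (hC : HasRange ψ C r s) (hD : HasRange ψ D r' s') (hrs : r ≤ s)
    (hrs' : r' ≤ s') {a b : ℝ} (ha : 0 < a) (hb : 0 < b) :
    ψ '' (a • C + b • D) = Icc (a * r + b * r') (a * s + b * s') := by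
  have h1 : (r : ℝ) ≤ s := by exact_mod_cast hrs
  have h2 : (r' : ℝ) ≤ s' := by exact_mod_cast hrs'
  have hr : (r : ℝ) ∈ ψ '' C := hC.image_eq ▸ left_mem_Icc.2 h1
  have hs : (s : ℝ) ∈ ψ '' C := hC.image_eq ▸ right_mem_Icc.2 h1
  have hr' : (r' : ℝ) ∈ ψ '' D := hD.image_eq ▸ left_mem_Icc.2 h2
  have hs' : (s' : ℝ) ∈ ψ '' D := hD.image_eq ▸ right_mem_Icc.2 h2
  apply Subset.antisymm
  · rintro _ ⟨_, ⟨_, ⟨c, hc, rfl⟩, _, ⟨d, hd, rfl⟩, rfl⟩, rfl⟩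
    have h1 : ψ c ∈ Icc (r : ℝ) s := hC.image_eq ▸ mem_image_of_mem ψ hc
    have h2 : ψ d ∈ Icc (r' : ℝ) s' := hD.image_eq ▸ mem_image_of_mem ψ hd
    obtain ⟨h1, h1'⟩ := h1
    obtain ⟨h2, h2'⟩ := h2
    simp only [map_add, map_smul, smul_eq_mul]
    constructor <;> gcongr
  · have hcv := ((hC.integral.convex.smul a).add (hD.integral.convex.smul b)).linear_image ψ
    have key : ∀ t t' : ℝ, t ∈ ψ '' C → t' ∈ ψ '' D → a * t + b * t' ∈ ψ '' (a • C + b • D) := by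
      rintro _ _ ⟨c, hc, rfl⟩ ⟨d, hd, rfl⟩
      exact ⟨a • c + b • d, add_mem_add (smul_mem_smul_set hc) (smul_mem_smul_set hd), by simp⟩
    exact hcv.ordConnected.out (key _ _ hr hr') (key _ _ hs hs')

theorem fiberPolytope_smul_add_smul (hC : HasRange ψ C r s) (hD : HasRange ψ D r' s') {p q : ℕ}
    (hp : r + p = s) (hq : r' + q = s') {a b : ℝ} (ha : 0 < a) (hb : 0 < b) :
    fiberPolytope ψ (a • C + b • D) = a ^ 2 • midSum ψ C p r +
      (a * b) • pathHull ψ C D p q r r' + b ^ 2 • midSum ψ D q r' := by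
  have hab := mul_pos ha hb
  have h1 := (hC.isPolytope_midSum p r le_rfl hp).smul (a ^ 2)
  have h2 := (isPolytope_pathHull hC hD p q r r' le_rfl hp le_rfl hq).smul (a * b)
  have h3 := (hD.isPolytope_midSum q r' le_rfl hq).smul (b ^ 2)
  have h := (h1.add h2).add h3
  rw [fiberPolytope_eq_secInt (image_smul_add_smul hC hD (by omega) (by omega) ha hb)]
  apply Subset.antisymm
  · intro y hy
    refine mem_of_forall_le_supp h.isCompact h.nonempty h.convex fun u => ?_
    have := pathBound _ C D r s r' s' hC hD a b ha hb p q r r' rfl le_rfl hp le_rfl hq u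
      (slopeBound_left C hD (by omega) u p r) (slopeBound_left D hC (by omega) u q r')
    rw [PathBound, hp, hq] at this
    rw [(h1.add h2).supp_add h3, h1.supp_add h2, supp_smul _ (sq_nonneg a), supp_smul _ hab.le,
      supp_smul _ (sq_nonneg b)]
    exact this y hy
  · rintro _ ⟨_, ⟨_, ⟨x, hx, rfl⟩, _, ⟨y, hy, rfl⟩, rfl⟩, _, ⟨z, hz, rfl⟩, rfl⟩
    exact sum_mem_secInt hC hD ha hb p q r r' le_rfl hp le_rfl hq x hx y hy z hz

theorem _root_.IsMixedFiberPolytope.unique {C D M M' : Set (Fin n → ℝ)}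
    (h : IsMixedFiberPolytope ψ C D M) (h' : IsMixedFiberPolytope ψ C D M') : M = M' := by
  obtain ⟨hM, A, B, hA, hB, h⟩ := h
  obtain ⟨hM', A', B', hA', hB', h'⟩ := h'
  refine hM.eq_of_supp_eq hM' fun u => ?_
  have key : ∀ a b : ℝ, 0 < a → 0 < b →
      a ^ 2 * supp u A + (a * b) * supp u M + b ^ 2 * supp u B =
        a ^ 2 * supp u A' + (a * b) * supp u M' + b ^ 2 * supp u B' := by
    intro a b ha hb
    have e := congrArg (supp u) ((h a b ha hb).symm.trans (h' a b ha hb))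
    rwa [((hA.smul _).add (hM.smul _)).supp_add (hB.smul _), (hA.smul _).supp_add (hM.smul _),
      ((hA'.smul _).add (hM'.smul _)).supp_add (hB'.smul _), (hA'.smul _).supp_add (hM'.smul _),
      supp_smul _ (sq_nonneg a), supp_smul _ (mul_pos ha hb).le, supp_smul _ (sq_nonneg b),
      supp_smul _ (sq_nonneg a), supp_smul _ (mul_pos ha hb).le, supp_smul _ (sq_nonneg b)] at e
  -- Three values of `(a, b)` already determine the coefficients of a binary quadratic form.
  have e1 := key 1 1 one_pos one_pos
  have e2 := key 2 1 two_pos one_pos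
  have e3 := key 1 2 one_pos two_pos
  linarith

/-- Existence of the mixed fiber polytope, and the case `a = b = 1` of its expansion. -/
theorem exists_isMixedFiberPolytope (hC : IsIntegralPolytope ψ C) (hD : IsIntegralPolytope ψ D) :
    ∃ M, IsMixedFiberPolytope ψ C D M ∧
      fiberPolytope ψ (C + D) = fiberPolytope ψ C + M + fiberPolytope ψ D := by
  obtain ⟨r, s, hrs, hr⟩ := hC.exists_image_eq_Icc
  obtain ⟨r', s', hrs', hr'⟩ := hD.exists_image_eq_Icc
  obtain ⟨p, hp⟩ := Int.le.dest hrs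
  obtain ⟨q, hq⟩ := Int.le.dest hrs'
  have hC : HasRange ψ C r s := ⟨hC, hr⟩
  have hD : HasRange ψ D r' s' := ⟨hD, hr'⟩
  refine ⟨pathHull ψ C D p q r r', ⟨isPolytope_pathHull hC hD p q r r' le_rfl hp le_rfl hq,
    midSum ψ C p r, midSum ψ D q r', hC.isPolytope_midSum p r le_rfl hp,
    hD.isPolytope_midSum q r' le_rfl hq,
    fun a b ha hb => fiberPolytope_smul_add_smul hC hD hp hq ha hb⟩, ?_⟩
  have := fiberPolytope_smul_add_smul hC hD hp hq one_pos one_pos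
  rw [hC.fiberPolytope_eq hp, hD.fiberPolytope_eq hq]
  simpa using this

theorem existsUnique_isMixedFiberPolytope (hC : IsIntegralPolytope ψ C)
    (hD : IsIntegralPolytope ψ D) : ∃! M, IsMixedFiberPolytope ψ C D M := by
  obtain ⟨M, hM, -⟩ := exists_isMixedFiberPolytope hC hD
  exact ⟨M, hM, fun M' hM' => hM'.unique hM⟩

theorem isMixedFiberPolytope_mixedFiberPolytope (hC : IsIntegralPolytope ψ C)
    (hD : IsIntegralPolytope ψ D) : IsMixedFiberPolytope ψ C D (mixedFiberPolytope ψ C D) := by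
  have h := (existsUnique_isMixedFiberPolytope hC hD).exists
  rw [mixedFiberPolytope, dif_pos h]
  exact h.choose_spec

theorem fiberPolytope_add (hC : IsIntegralPolytope ψ C) (hD : IsIntegralPolytope ψ D) :
    fiberPolytope ψ (C + D) =
      fiberPolytope ψ C + mixedFiberPolytope ψ C D + fiberPolytope ψ D := by
  obtain ⟨M, hM, h⟩ := exists_isMixedFiberPolytope hC hD
  rw [h, hM.unique (isMixedFiberPolytope_mixedFiberPolytope hC hD)]

/-! ### Faces of fiber polytopes -/

theorem HasRange.psiMin_eq (h : HasRange ψ P r s) (hrs : r ≤ s) : psiMin ψ P = r := by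
  rw [psiMin, h.image_eq, csInf_Icc (by exact_mod_cast hrs)]

theorem HasRange.psiMax_eq (h : HasRange ψ P r s) (hrs : r ≤ s) : psiMax ψ P = s := by
  rw [psiMax, h.image_eq, csSup_Icc (by exact_mod_cast hrs)]

theorem sliceFaceSum_intCast (w : Fin n → ℝ) (P : Set (Fin n → ℝ)) (a b : ℤ) :
    sliceFaceSum ψ w P a b = ∑ i ∈ Finset.Ico a b, face w (slice ψ P (i + 1 / 2)) := by
  unfold sliceFaceSum
  have : (b : ℝ) - 1 = ((b - 1 : ℤ) : ℝ) := by push_cast; rfl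
  rw [this, Int.ceil_intCast, Int.floor_intCast]
  refine Finset.sum_congr ?_ fun _ _ => rfl
  ext k
  simp only [Finset.mem_Icc, Finset.mem_Ico]
  omega

theorem HasRange.fiberPolytope_eq_sum (h : HasRange ψ P r s) (hrs : r ≤ s) :
    fiberPolytope ψ P = ∑ i ∈ Finset.Ico r s, slice ψ P (i + 1 / 2) := by
  obtain ⟨p, hp⟩ := Int.le.dest hrs
  rw [h.fiberPolytope_eq hp, midSum_eq_sum p r s hp]

/-- Once the slice contains a global maximizer of `w` on `P`, its own maximum equals the global one.
-/
theorem face_slice_eq_slice_face {w : Fin n → ℝ} {t : ℝ} (h : (slice ψ (face w P) t).Nonempty) :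
    face w (slice ψ P t) = slice ψ (face w P) t := by
  obtain ⟨x, hx, hxt⟩ := h
  ext y
  constructor
  · rintro ⟨hy, hy'⟩
    exact ⟨mem_face_of_le hx hy.1 (hy' x ⟨hx.1, hxt⟩), hy.2⟩
  · rintro ⟨hy, hyt⟩
    exact ⟨⟨hy.1, hyt⟩, fun z hz => hy.2 z hz.1⟩

theorem sum_Ico_consecutive_int {M : Type*} [AddCommMonoid M] (f : ℤ → M) {a b c : ℤ}
    (hab : a ≤ b) (hbc : b ≤ c) :
    ∑ i ∈ Finset.Ico a c, f i = ∑ i ∈ Finset.Ico a b, f i + ∑ i ∈ Finset.Ico b c, f i := by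
  rw [← Finset.Ico_union_Ico_eq_Ico hab hbc,
    Finset.sum_union (Finset.Ico_disjoint_Ico_consecutive a b c)]

theorem IsIntegralPolytope.exists_hasRange_face (hP : IsIntegralPolytope ψ P) (w : Fin n → ℝ) :
    ∃ r s r' s' : ℤ, r ≤ r' ∧ r' ≤ s' ∧ s' ≤ s ∧ HasRange ψ P r s ∧
      HasRange ψ (_root_.face w P) r' s' := by
  obtain ⟨r, s, hrs, h⟩ := hP.exists_image_eq_Icc
  obtain ⟨r', s', hrs', h'⟩ := (hP.face w).exists_image_eq_Icc
  have hsub : Icc (r' : ℝ) s' ⊆ Icc (r : ℝ) s := by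
    rw [← h, ← h']
    exact image_mono fun x hx => hx.1
  obtain ⟨h1, h2⟩ := (Icc_subset_Icc_iff (by exact_mod_cast hrs')).1 hsub
  exact ⟨r, s, r', s', by exact_mod_cast h1, hrs', by exact_mod_cast h2, ⟨hP, h⟩,
    ⟨hP.face w, h'⟩⟩

/-- The unit intervals in `ψ '' P` split into those below, inside and above `ψ '' face w P`. The
inner ones assemble to the fiber polytope of the face, and the outer ones are the two correction
sums. -/
theorem face_fiberPolytope (hP : IsIntegralPolytope ψ P) (w : Fin n → ℝ) :
    face w (fiberPolytope ψ P) = fiberPolytope ψ (face w P) +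
      sliceFaceSum ψ w P (psiMin ψ P) (psiMin ψ (face w P)) +
      sliceFaceSum ψ w P (psiMax ψ (face w P)) (psiMax ψ P) := by
  obtain ⟨r, s, r', s', h1, hrs', h2, hP, hF⟩ := hP.exists_hasRange_face w
  have hrs : r ≤ s := by omega
  rw [hP.psiMin_eq hrs, hP.psiMax_eq hrs, hF.psiMin_eq hrs', hF.psiMax_eq hrs',
    sliceFaceSum_intCast, sliceFaceSum_intCast, hP.fiberPolytope_eq_sum hrs,
    hF.fiberPolytope_eq_sum hrs', face_sum,
    sum_Ico_consecutive_int _ (h1.trans hrs') h2, sum_Ico_consecutive_int _ h1 hrs']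
  have : ∑ i ∈ Finset.Ico r' s', face w (slice ψ P (i + 1 / 2)) =
      ∑ i ∈ Finset.Ico r' s', slice ψ (face w P) (i + 1 / 2) := by
    refine Finset.sum_congr rfl fun i hi => face_slice_eq_slice_face ?_
    rw [Finset.mem_Ico] at hi
    exact (hF.isPolytope_half hi.1 (by omega)).nonempty
  rw [this, add_comm (∑ i ∈ Finset.Ico r r', _)]

theorem isPolytope_sum {ι : Type*} (t : Finset ι) (K : ι → Set (Fin n → ℝ))
    (h : ∀ i ∈ t, IsPolytope (K i)) : IsPolytope (∑ i ∈ t, K i) := by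
  classical
  induction t using Finset.induction_on with
  | empty => exact isPolytope_singleton_zero
  | insert i t hi ih =>
    rw [Finset.sum_insert hi]
    exact (h i (Finset.mem_insert_self i t)).add
      (ih fun k hk => h k (Finset.mem_insert_of_mem hk))

theorem HasRange.isPolytope_sliceFaceSum (h : HasRange ψ P r s) (w : Fin n → ℝ) {a b : ℤ}
    (ha : r ≤ a) (hb : b ≤ s) : IsPolytope (sliceFaceSum ψ w P a b) := by
  rw [sliceFaceSum_intCast]
  refine isPolytope_sum _ _ fun i hi => isPolytope_face (h.isPolytope_half ?_ ?_) w
  all_goals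
    rw [Finset.mem_Ico] at hi
    omega

theorem IsIntegralPolytope.isPolytope_sliceFaceSum_left (hP : IsIntegralPolytope ψ P)
    (w : Fin n → ℝ) : IsPolytope (sliceFaceSum ψ w P (psiMin ψ P) (psiMin ψ (_root_.face w P))) := by
  obtain ⟨r, s, r', s', h1, hrs', h2, hP, hF⟩ := hP.exists_hasRange_face w
  rw [hP.psiMin_eq (by omega), hF.psiMin_eq hrs']
  exact hP.isPolytope_sliceFaceSum w le_rfl (by omega)

theorem IsIntegralPolytope.isPolytope_sliceFaceSum_right (hP : IsIntegralPolytope ψ P)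
    (w : Fin n → ℝ) : IsPolytope (sliceFaceSum ψ w P (psiMax ψ (_root_.face w P)) (psiMax ψ P)) := by
  obtain ⟨r, s, r', s', h1, hrs', h2, hP, hF⟩ := hP.exists_hasRange_face w
  rw [hP.psiMax_eq (by omega), hF.psiMax_eq hrs']
  exact hP.isPolytope_sliceFaceSum w (by omega) le_rfl

theorem IsIntegralPolytope.isPolytope_fiberPolytope (hP : IsIntegralPolytope ψ P) :
    IsPolytope (fiberPolytope ψ P) := by
  obtain ⟨r, s, hrs, h⟩ := hP.exists_image_eq_Icc
  obtain ⟨p, hp⟩ := Int.le.dest hrs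
  have hP : HasRange ψ P r s := ⟨hP, h⟩
  rw [hP.fiberPolytope_eq hp]
  exact hP.isPolytope_midSum p r le_rfl hp

end FiberPolytope

/-! ### The main theorem. -/

open FiberPolytope in
theorem theorem4p9 {m : ℕ} (A : Matrix (Fin m) (Fin (m + 1)) ℚ) (hA : A.rank = m)
    (ψ : (Fin (m + 1) → ℝ) →ₗ[ℝ] ℝ) (hψ : IsComplementaryMap A ψ)
    (C D : Set (Fin (m + 1) → ℝ)) (hC : IsLatticePolytope C) (hD : IsLatticePolytope D)
    (w : Fin (m + 1) → ℝ) :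
    (∃! M, IsMixedFiberPolytope ψ C D M) ∧
    (∃! M, IsMixedFiberPolytope ψ (face w C) (face w D) M) ∧
    mixedFiberPolytope ψ (face w C) (face w D)
        + sliceFaceSum ψ w (C + D) (psiMin ψ (C + D)) (psiMin ψ (face w (C + D)))
        + sliceFaceSum ψ w (C + D) (psiMax ψ (face w (C + D))) (psiMax ψ (C + D))
      = face w (mixedFiberPolytope ψ C D)
        + sliceFaceSum ψ w C (psiMin ψ C) (psiMin ψ (face w C))
        + sliceFaceSum ψ w C (psiMax ψ (face w C)) (psiMax ψ C)
        + sliceFaceSum ψ w D (psiMin ψ D) (psiMin ψ (face w D))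
        + sliceFaceSum ψ w D (psiMax ψ (face w D)) (psiMax ψ D) := by
  have iC : IsIntegralPolytope ψ C := hC.isIntegralPolytope hψ.2
  have iD : IsIntegralPolytope ψ D := hD.isIntegralPolytope hψ.2
  have iFC := iC.face w
  have iFD := iD.face w
  have iCD := iC.add iD
  refine ⟨existsUnique_isMixedFiberPolytope iC iD, existsUnique_isMixedFiberPolytope iFC iFD, ?_⟩
  have hM := (isMixedFiberPolytope_mixedFiberPolytope iC iD).1
  have hM' := (isMixedFiberPolytope_mixedFiberPolytope iFC iFD).1
  -- The summand to be cancelled: it appears on one side through the faces of the fiber polytopes of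
  -- `C` and `D`, and on the other through the expansion for `face w C + face w D`.
  have hS := iFC.isPolytope_fiberPolytope.add iFD.isPolytope_fiberPolytope
  refine ((hM'.add (iCD.isPolytope_sliceFaceSum_left w)).add
    (iCD.isPolytope_sliceFaceSum_right w)).add_right_cancel
    (((((isPolytope_face hM w).add (iC.isPolytope_sliceFaceSum_left w)).add
      (iC.isPolytope_sliceFaceSum_right w)).add (iD.isPolytope_sliceFaceSum_left w)).add
      (iD.isPolytope_sliceFaceSum_right w)) hS ?_
  have e1 := face_fiberPolytope iCD w
  rw [fiberPolytope_add iC iD, face_add, face_add, face_fiberPolytope iC w,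
    face_fiberPolytope iD w] at e1
  have e2 := fiberPolytope_add iFC iFD
  rw [← face_add] at e2
  rw [e2] at e1
  calc _ = _ := by ac_rfl
    _ = _ := e1.symm
    _ = _ := by ac_rfl
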